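/- Let $P\subseteq\mathbb R^d$ be a $d$-dimensional lattice polytope (the convex hull of finitely many points of $\mathbb Z^d$), let $m_1,\dots,m_s$ be an enumeration without repetition of $P\cap\mathbb Z^d$, and let $w=(w_1,\dots,w_s)$ be positive real weights. Let $X_{\mathscr A,w}\subseteq\mathbb P^{s-1}_{\mathbb C}$ be the Zariski closure of $\{[w_1t^{m_1}:\dots:w_st^{m_s}] : t\in(\mathbb C^*)^d\}$. Let $Y_{\mathscr A,w}\subseteq(\mathbb C^*)^s$, the scaled very affine toric variety, be the image of $X_{\mathscr A,w}\setminus\mathbf V(x_1\cdots x_s(x_1+\dots+x_s))$ under $[x_1:\dots:x_s]\mapsto\frac{1}{x_1+\dots+x_s}(x_1,\dots,x_s)$; it is a nonsingular closed subvariety of $(\mathbb C^*)^s$. We say that $Y_{\mathscr A,w}$ has ML degree one if, for generic $u\in\mathbb Z_{>0}^s$ (that is, for all $u\in\mathbb Z_{>0}^s$ outside some proper Zariski closed subset of $\mathbb C^s$), the function $\ell_u(x)=x_1^{u_1}\cdots x_s^{u_s}$ on $Y_{\mathscr A,w}$ has exactly one critical point. We say that $P$ has rational linear precision for $w$ if there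 are rational functions $\hat\beta_1,\dots,\hat\beta_s$ on $\mathbb C^d$ such that: 1. $\sum_{j=1}^s\hat\beta_j=1$ as rational functions; 2. $t\mapsto[\hat\beta_1(t):\dots:\hat\beta_s(t)]$ is a rational parametrization of $X_{\mathscr A,w}$, i.e. a rational map $\mathbb C^d\dashrightarrow X_{\mathscr A,w}$ with Zariski dense image; 3. every $\hat\beta_j$ is defined on $P$ by continuity (its restriction to the points of $P$ at which it is regular extends to a continuous function on all of $P$), and the resulting values $\hat\beta_j(p)$, $p\in P$, are nonnegative real numbers; 4. $\sum_{j=1}^s\hat\beta_j(p)\,m_j=p$ for all $p\in P$. Then $P$ has rational linear precision for the weights $w$ if and only if $Y_{\mathscr A,w}$ has ML degree one. -/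

import Mathlib

open scoped LinearAlgebra.Projectivization

namespace ToricML

noncomputable section

/-! ### Lattice polytopes -/

/-- The point of `ℝ^d` with the given integer coordinates. -/
def latticeToReal {d : ℕ} (a : Fin d → ℤ) : Fin d → ℝ := fun i => (a i : ℝ)

/-- The point of `ℂ^d` with the given real coordinates. -/
def realToComplex {d : ℕ} (p : Fin d → ℝ) : Fin d → ℂ := fun i => (p i : ℂ)

/-- `P` is a lattice polytope: the convex hull of finitely many points of `ℤ^d`. -/
def IsLatticePolytope {d : ℕ} (P : Set (Fin d → ℝ)) : Prop :=
  ∃ V : Finset (Fin d → ℤ), P = convexHull ℝ (latticeToReal '' (V : Set (Fin d → ℤ)))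

/-- `m 0, …, m (s - 1)` is an enumeration without repetition of the set `P ∩ ℤ^d`. -/
def EnumeratesLatticePoints {d s : ℕ} (P : Set (Fin d → ℝ)) (m : Fin s → Fin d → ℤ) : Prop :=
  Function.Injective m ∧ Set.range m = {a | latticeToReal a ∈ P}

/-! ### The scaled toric varieties -/

/-- The Zariski closure of a subset of the projective space `ℙ^(s-1)` over `ℂ`: the common zeros of
all homogeneous polynomials that vanish on it. -/
def projZariskiClosure {s : ℕ} (S : Set (ℙ ℂ (Fin s → ℂ))) : Set (ℙ ℂ (Fin s → ℂ)) :=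
  {x | ∀ (n : ℕ) (F : MvPolynomial (Fin s) ℂ), F.IsHomogeneous n →
    (∀ y ∈ S, MvPolynomial.eval y.rep F = 0) → MvPolynomial.eval x.rep F = 0}

/-- The vector `(w_1 t^{m_1}, …, w_s t^{m_s})` for a point `t` of the torus `(ℂ^*)^d`. -/
def scaledMonomials {d s : ℕ} (m : Fin s → Fin d → ℤ) (w : Fin s → ℝ) (t : Fin d → ℂˣ) :
    Fin s → ℂ :=
  fun j => (w j : ℂ) * ((∏ i, t i ^ m j i : ℂˣ) : ℂ)

/-- The scaled projective toric variety `X_{A,w}`: the Zariski closure in `ℙ^(s-1)` of the set of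
the points `[w_1 t^{m_1} : … : w_s t^{m_s}]` with `t ∈ (ℂ^*)^d`. -/
def scaledProjToric {d s : ℕ} (m : Fin s → Fin d → ℤ) (w : Fin s → ℝ) :
    Set (ℙ ℂ (Fin s → ℂ)) :=
  projZariskiClosure {x | ∃ (t : Fin d → ℂˣ) (h : scaledMonomials m w t ≠ 0),
    x = Projectivization.mk ℂ (scaledMonomials m w t) h}

/-- The scaled very affine toric variety `Y_{A,w} ⊆ (ℂ^*)^s`: the image of
`X_{A,w} ∖ V(x_1 ⋯ x_s (x_1 + ⋯ + x_s))` under `[x] ↦ (x_1 + ⋯ + x_s)⁻¹ (x_1, …, x_s)`. -/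
def scaledVeryAffineToric {d s : ℕ} (m : Fin s → Fin d → ℤ) (w : Fin s → ℝ) :
    Set (Fin s → ℂ) :=
  {y | ∃ x ∈ scaledProjToric m w, (∀ j, x.rep j ≠ 0) ∧ (∑ k, x.rep k ≠ 0) ∧
    y = (∑ k, x.rep k)⁻¹ • x.rep}

/-! ### Maximum likelihood degree -/

/-- The differential at `x` of the polynomial function `F`, applied to the vector `v`. -/
def polyDifferential {s : ℕ} (F : MvPolynomial (Fin s) ℂ) (x v : Fin s → ℂ) : ℂ :=
  ∑ j, MvPolynomial.eval x (MvPolynomial.pderiv j F) * v j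

/-- `v` lies in the Zariski tangent space at `x` of (the reduced variety) `Y`. -/
def IsTangentAt {s : ℕ} (Y : Set (Fin s → ℂ)) (x v : Fin s → ℂ) : Prop :=
  ∀ F : MvPolynomial (Fin s) ℂ, (∀ y ∈ Y, MvPolynomial.eval y F = 0) → polyDifferential F x v = 0

/-- The critical points on a nonsingular very affine variety `Y ⊆ (ℂ^*)^s` of the likelihood
function `ℓ_u(x) = x_1^{u_1} ⋯ x_s^{u_s}`: the points of `Y` at which the differential of `ℓ_u`
vanishes on the tangent space of `Y`. (`Y_{A,w}` is nonsingular: it is isomorphic to an open subset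
of the torus orbit of points of `X_{A,w}` without zero coordinates.) -/
def likelihoodCriticalPoints {s : ℕ} (Y : Set (Fin s → ℂ)) (u : Fin s → ℕ) : Set (Fin s → ℂ) :=
  {x | x ∈ Y ∧ ∀ v, IsTangentAt Y x v →
    polyDifferential (∏ j, (MvPolynomial.X j : MvPolynomial (Fin s) ℂ) ^ u j) x v = 0}

/-- `Y` has ML degree `n`: for generic `u ∈ ℤ_{>0}^s`, that is, for all `u` outside a proper
Zariski closed set, `ℓ_u` has exactly `n` critical points on `Y`. -/
def HasMLDegree {s : ℕ} (Y : Set (Fin s → ℂ)) (n : ℕ) : Prop :=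
  ∃ G : MvPolynomial (Fin s) ℂ, G ≠ 0 ∧ ∀ u : Fin s → ℕ, (∀ j, 0 < u j) →
    MvPolynomial.eval (fun j => (u j : ℂ)) G ≠ 0 →
      (likelihoodCriticalPoints Y u).encard = (n : ℕ∞)

/-! ### Rational linear precision -/

/-- The field of rational functions on `ℂ^d`. -/
abbrev RatFun (d : ℕ) : Type := FractionRing (MvPolynomial (Fin d) ℂ)

/-- The rational function `r` is regular at `p`, with value `c`. -/
def HasValueAt {d : ℕ} (r : RatFun d) (p : Fin d → ℂ) (c : ℂ) : Prop :=
  ∃ f g : MvPolynomial (Fin d) ℂ, MvPolynomial.eval p g ≠ 0 ∧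
    r = algebraMap _ (RatFun d) f / algebraMap _ (RatFun d) g ∧
    c = MvPolynomial.eval p f / MvPolynomial.eval p g

/-- The image of the rational map `ℂ^d ⇢ ℙ^(s-1)` given by a tuple of rational functions: its values
at the points where all of them are regular and not all of them vanish. -/
def ratMapImage {d s : ℕ} (b : Fin s → RatFun d) : Set (ℙ ℂ (Fin s → ℂ)) :=
  {x | ∃ (p : Fin d → ℂ) (c : Fin s → ℂ) (h : c ≠ 0),
    (∀ j, HasValueAt (b j) p (c j)) ∧ x = Projectivization.mk ℂ c h}

/-- The real function `φ` is the continuous extension to `P` of the restriction of the rational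
function `r` to the points of `P` where `r` is regular. For full-dimensional convex `P` there is at
most one such function on `P`, because the points where `r` is regular are dense in `P`. -/
def IsContinuousExtensionOn {d : ℕ} (P : Set (Fin d → ℝ)) (r : RatFun d)
    (φ : (Fin d → ℝ) → ℝ) : Prop :=
  ContinuousOn φ P ∧ ∀ p ∈ P, ∀ c : ℂ, HasValueAt r (realToComplex p) c → c = (φ p : ℂ)

/-- `P`, with lattice points `m_1, …, m_s`, has rational linear precision for the weights `w`.
The blending functions `b_j` need to be defined on `P` in the sense that they extend continuously to
`P`: at a boundary point of `P`, reduced numerator and denominator may vanish simultaneously. -/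
def HasRationalLinearPrecision {d s : ℕ} (P : Set (Fin d → ℝ)) (m : Fin s → Fin d → ℤ)
    (w : Fin s → ℝ) : Prop :=
  ∃ b : Fin s → RatFun d,
    (∑ j, b j = 1) ∧
    projZariskiClosure (ratMapImage b) = scaledProjToric m w ∧
    ∃ φ : Fin s → (Fin d → ℝ) → ℝ,
      (∀ j, IsContinuousExtensionOn P (b j) (φ j)) ∧
      (∀ j, ∀ p ∈ P, 0 ≤ φ j p) ∧
      ∀ p ∈ P, ∑ j, φ j p • latticeToReal (m j) = p

end

end ToricML

/-! Both conditions describe the moment map `y ↦ ∑ y_j m_j` on `Y`. By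
`mem_likelihoodCriticalPoints_iff`, the critical points of `ℓ_u` are the points of `Y` whose moment
is that of the normalized data `u / ∑ u_j`. So ML degree one says that the generic fibre over such
data is a single point, while rational linear precision says that the moment map has a rational
section with dense image which behaves well on `P`.

From precision to ML degree: blending functions form a section of the moment map. Their image is
Zariski dense in `X`, so the identity "point = section of its moment" spreads from the image to all
of `Y`. Each generic fibre is then exactly the value of the section.

From ML degree to precision: the fibre equations over `ℂ[X_1, …, X_d]` have a unique solution at a
Zariski dense set of parameters. By `exists_solution_of_unique_specializations` they have a solution
over the field of rational functions: the Nullstellensatz gives an algebraic one, and a second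
Galois conjugate would specialize to a second point of a fibre. It remains to control this solution
on `P`. By Birch's theorem (`exists_continuous_moment_inverse`) the moment map has a continuous
inverse `φ` on `P` with values in the simplex, positive over the interior. Uniqueness of the fibre
point forces the rational solution to agree with `φ` on a dense subset of `P` away from the poles,
so `φ` is its continuous extension, and nonnegativity and linear precision are read off from `φ`. -/

namespace ToricML

open MvPolynomial

/-! ### Specialization and descent of solutions of polynomial systems -/

section Algebra

/-- A ring homomorphism into an algebraically closed field extends along integral extensions. -/
theorem exists_ringHom_extension_of_isIntegral {A B k : Type*} [CommRing A] [CommRing B]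
    [Algebra A B] [FaithfulSMul A B] [Algebra.IsIntegral A B] [Field k] [IsAlgClosed k]
    (ε : A →+* k) : ∃ ψ : B →+* k, ψ.comp (algebraMap A B) = ε := by
  have : (RingHom.ker ε).IsPrime := RingHom.ker_isPrime ε
  obtain ⟨Q, -, hQ, hQP⟩ := Ideal.exists_ideal_over_prime_of_isIntegral (S := B) (RingHom.ker ε) ⊥
    (by rw [← RingHom.ker_eq_comap_bot,
          (RingHom.injective_iff_ker_eq_bot _).1 (FaithfulSMul.algebraMap_injective A B)]
        exact bot_le)
  have : Q.LiesOver (RingHom.ker ε) := ⟨hQP.symm⟩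
  let : Algebra (A ⧸ RingHom.ker ε) k := (RingHom.kerLift ε).toAlgebra
  have : Module.IsTorsionFree (A ⧸ RingHom.ker ε) k := by
    rw [Module.isTorsionFree_iff_algebraMap_injective]
    exact RingHom.kerLift_injective ε
  have : Algebra.IsIntegral (A ⧸ RingHom.ker ε) (B ⧸ Q) := inferInstance
  have : Module.IsTorsionFree (A ⧸ RingHom.ker ε) (B ⧸ Q) := by
    rw [Module.isTorsionFree_iff_algebraMap_injective]
    exact FaithfulSMul.algebraMap_injective _ _
  -- `ε` embeds `A ⧸ ker ε` into `k`, and `B ⧸ Q` is an integral domain extension of it, hence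
  -- embeds into the algebraically closed field `k` over it.
  let θ : (B ⧸ Q) →ₐ[A ⧸ RingHom.ker ε] k := IsAlgClosed.lift
  refine ⟨(θ : (B ⧸ Q) →+* k).comp (Ideal.Quotient.mk Q), ?_⟩
  ext a
  have h1 : (Ideal.Quotient.mk Q) (algebraMap A B a) =
      algebraMap (A ⧸ RingHom.ker ε) (B ⧸ Q) (Ideal.Quotient.mk _ a) := rfl
  simp only [RingHom.comp_apply, h1]
  exact (θ.commutes _).trans rfl

/-- Finitely many elements algebraic over a domain can be specialized along generic homomorphisms
from the domain to an algebraically closed field. -/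
theorem exists_specialization {A Ω k ι : Type*} [CommRing A] [IsDomain A] [Field Ω] [Algebra A Ω]
    [FaithfulSMul A Ω] [Algebra.IsAlgebraic A Ω] [Field k] [IsAlgClosed k] [Finite ι] (z : ι → Ω) :
    ∃ g : A, g ≠ 0 ∧ ∀ ε : A →+* k, ε g ≠ 0 → ∃ z' : ι → k, ∀ F : MvPolynomial ι A,
      aeval z F = 0 → eval₂ ε z' F = 0 := by
  classical
  have := Fintype.ofFinite ι
  -- A common denominator: every `g • z i` is integral over `A`. When `ε g ≠ 0`, `ε` extends to the
  -- integral closure `B`, then to `B[1/g]`, which contains all the `z i`.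
  obtain ⟨g, hg0, hg⟩ := Algebra.IsAlgebraic.exists_integral_multiples A (Finset.univ.image z)
  refine ⟨g, hg0, fun ε hε => ?_⟩
  let B := integralClosure A Ω
  have : FaithfulSMul A B := by
    rw [faithfulSMul_iff_algebraMap_injective]
    intro a b hab
    exact FaithfulSMul.algebraMap_injective A Ω (congrArg (Subtype.val) hab)
  obtain ⟨ψ, hψ⟩ := exists_ringHom_extension_of_isIntegral (B := B) ε
  have hψ' : ∀ a, ψ (algebraMap A B a) = ε a := fun a => by rw [← hψ]; rfl
  let gB : B := algebraMap A B g
  have hgB : gB ≠ 0 := fun h => hg0 (FaithfulSMul.algebraMap_injective A B (by rw [map_zero]; exact h))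
  have hgΩ : (gB : Ω) ≠ 0 := fun h => hgB (Subtype.ext h)
  let Bg := Localization.Away gB
  let lam : Bg →+* Ω := IsLocalization.Away.lift gB (g := algebraMap B Ω) hgΩ.isUnit
  have hlam : Function.Injective lam := by
    refine IsLocalization.lift_injective_iff (M := Submonoid.powers gB) _ |>.2 ?_
    intro x y
    have hi : Function.Injective (algebraMap B Bg) :=
      IsLocalization.injective _ (powers_le_nonZeroDivisors_of_noZeroDivisors hgB)
    exact ⟨fun h => congrArg _ (hi h), fun h => congrArg _ (Subtype.ext h)⟩
  have hψg : ψ gB ≠ 0 := by rw [hψ' g]; exact hε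
  let kap : Bg →+* k := IsLocalization.Away.lift gB (g := ψ) hψg.isUnit
  have hlam_alg : ∀ b : B, lam (algebraMap B Bg b) = b := fun b =>
    IsLocalization.Away.lift_eq gB hgΩ.isUnit b
  have hkap_alg : ∀ b : B, kap (algebraMap B Bg b) = ψ b := fun b =>
    IsLocalization.Away.lift_eq gB hψg.isUnit b
  let gz : ι → B := fun i => ⟨g • z i, hg _ (Finset.mem_image_of_mem z (Finset.mem_univ i))⟩
  let ζ : ι → Bg := fun i => algebraMap B Bg (gz i) * IsLocalization.Away.invSelf gB
  have hζ : ∀ i, lam (ζ i) = z i := by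
    intro i
    have h1 : algebraMap B Bg gB * IsLocalization.Away.invSelf gB = 1 :=
      IsLocalization.Away.mul_invSelf gB
    have h2 : (gB : Ω) * lam (IsLocalization.Away.invSelf gB) = 1 := by
      rw [← hlam_alg, ← map_mul, h1, map_one]
    have h3 : ((gz i : B) : Ω) = (gB : Ω) * z i := Algebra.smul_def g (z i)
    simp only [ζ, map_mul, hlam_alg]
    rw [h3, mul_right_comm, h2, one_mul]
  refine ⟨fun i => kap (ζ i), fun F hF => ?_⟩
  let ι₀ : A →+* Bg := (algebraMap B Bg).comp (algebraMap A B)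
  -- Relations are tested in `Ω`, into which `B[1/g]` embeds by `lam`; applying `kap` afterwards
  -- transports them to `k`.
  have key : eval₂ ι₀ ζ F = 0 := by
    apply hlam
    rw [map_zero, ← hF, eval₂_comp_left, aeval_def]
    congr 1
    · ext a; exact hlam_alg _
    · funext i; exact hζ i
  have := congrArg kap key
  rw [map_zero, eval₂_comp_left] at this
  rw [← this]
  congr 1
  ext a
  exact ((hkap_alg _).trans (hψ' a)).symm

attribute [local instance] MvPolynomial.algebraMvPolynomial in
/-- A polynomial system over a domain without solution over the algebraic closure of the
field of fractions has a nonzero constant in its ideal. -/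
theorem exists_C_mem_span_of_no_zero {A σ : Type*} [CommRing A] [IsDomain A] [Finite σ]
    (J : Set (MvPolynomial σ A))
    (hJ : ∀ y : σ → AlgebraicClosure (FractionRing A), ∃ F ∈ J, aeval y F ≠ 0) :
    ∃ a : A, a ≠ 0 ∧ (C a : MvPolynomial σ A) ∈ Ideal.span J := by
  let L := FractionRing A
  let I : Ideal (MvPolynomial σ L) := (Ideal.span J).map (algebraMap _ (MvPolynomial σ L))
  have hemp : zeroLocus (AlgebraicClosure L) I = ∅ := by
    rw [Set.eq_empty_iff_forall_notMem]
    intro y hy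
    obtain ⟨F, hF, hne⟩ := hJ y
    apply hne
    have := hy _ (Ideal.mem_map_of_mem _ (Ideal.subset_span hF))
    rwa [algebraMap_def, aeval_map_algebraMap] at this
  have h1 : I = ⊤ := by
    rw [← Ideal.radical_eq_top, ← vanishingIdeal_zeroLocus_eq_radical (K := AlgebraicClosure L),
      hemp]
    rw [Ideal.eq_top_iff_one]
    intro x hx
    exact absurd hx (Set.notMem_empty x)
  have h2 : (1 : MvPolynomial σ L) ∈ I := h1 ▸ Submodule.mem_top
  -- `L[σ]` is the localization of `A[σ]` at the nonzero constants, so membership of 1 in the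
  -- extended ideal means that some nonzero constant lies in the original one.
  rw [IsLocalization.mem_map_algebraMap_iff ((nonZeroDivisors A).map (C (σ := σ)))] at h2
  obtain ⟨⟨x, ⟨_, c, hc, rfl⟩⟩, hx⟩ := h2
  refine ⟨c, nonZeroDivisors.ne_zero hc, ?_⟩
  have hinj : Function.Injective (algebraMap (MvPolynomial σ A) (MvPolynomial σ L)) := by
    rw [algebraMap_def]
    exact map_injective _ (IsFractionRing.injective A L)
  rw [one_mul] at hx
  have hcx : (C c : MvPolynomial σ A) = x := hinj hx
  rw [hcx]
  exact x.2

/-- If a polynomial system over `A` has, for each `ε` in a dense set of homomorphisms to an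
algebraically closed field, a unique solution, then it has a solution over the field of
fractions of `A`. -/
theorem exists_solution_of_unique_specializations {A k σ : Type*} [CommRing A] [IsDomain A]
    [CharZero A] [Field k] [IsAlgClosed k] [Finite σ] (J : Set (MvPolynomial σ A))
    (D : Set (A →+* k)) (hD : ∀ a : A, (∀ ε ∈ D, ε a = 0) → a = 0)
    (hJ : ∀ ε ∈ D, ∃ y : σ → k, ∀ F ∈ J, eval₂ ε y F = 0)
    (huniq : ∀ ε ∈ D, ∀ y y' : σ → k, (∀ F ∈ J, eval₂ ε y F = 0) →
      (∀ F ∈ J, eval₂ ε y' F = 0) → y = y') :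
    ∃ b : σ → FractionRing A, ∀ F ∈ J, aeval b F = 0 := by
  let L := FractionRing A
  let Ω := AlgebraicClosure L
  have : CharZero L := charZero_of_injective_algebraMap (IsFractionRing.injective A L)
  have : Algebra.IsAlgebraic A Ω :=
    (IsFractionRing.comap_isAlgebraic_iff (A := A) (K := L) (C := Ω)).2 inferInstance
  have hinj : Function.Injective (algebraMap A Ω) := by
    rw [IsScalarTower.algebraMap_eq A L Ω]
    exact (algebraMap L Ω).injective.comp (IsFractionRing.injective A L)
  have : FaithfulSMul A Ω := (faithfulSMul_iff_algebraMap_injective A Ω).2 hinj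
  obtain ⟨y, hy⟩ : ∃ y : σ → Ω, ∀ F ∈ J, aeval y F = 0 := by
    -- Without a solution over `Ω`, some nonzero `a : A` lies in the ideal; it must vanish under
    -- every `ε ∈ D`, since the system is solvable there, and `D` is dense.
    by_contra! hcon
    obtain ⟨a, ha, haJ⟩ := exists_C_mem_span_of_no_zero J hcon
    refine ha (hD a fun ε hε => ?_)
    obtain ⟨y, hy⟩ := hJ ε hε
    have : Ideal.span J ≤ RingHom.ker (eval₂Hom ε y) := Ideal.span_le.2 fun F hF => hy F hF
    simpa [RingHom.mem_ker] using this haJ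
  have hbot : ∀ j, y j ∈ (⊥ : Subalgebra L Ω) := by
    intro j
    by_contra hj
    rw [notMem_iff_exists_ne_and_isConjRoot (Algebra.IsSeparable.isSeparable L (y j))
      (IsAlgClosed.splits _)] at hj
    obtain ⟨y₁, hne, hconj⟩ := hj
    obtain ⟨τ, hτ⟩ := hconj.symm.exists_algEquiv
    have hτA : ∀ F ∈ J, aeval (fun i => τ (y i)) F = 0 := by
      intro F hF
      have h := congrArg τ (hy F hF)
      rw [map_zero] at h
      rw [← h]
      have := (comp_aeval_apply (f := y) ((τ : Ω →ₐ[L] Ω).restrictScalars A) F).symm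
      simpa using this
    -- Both conjugate solutions are specialized together with the inverse of their difference at
    -- `j`, which keeps the two specializations distinct.
    let z : (σ ⊕ σ) ⊕ Unit → Ω := Sum.elim (Sum.elim y fun i => τ (y i)) fun _ => (y j - τ (y j))⁻¹
    obtain ⟨g, hg0, hg⟩ := exists_specialization (A := A) (k := k) z
    obtain ⟨ε, hε, hεg⟩ : ∃ ε ∈ D, ε g ≠ 0 := by
      by_contra! hcon
      exact hg0 (hD g hcon)
    obtain ⟨z', hz'⟩ := hg ε hεg
    have e1 : ∀ F ∈ J, eval₂ ε (fun i => z' (.inl (.inl i))) F = 0 := by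
      intro F hF
      have := hz' (rename (fun i => Sum.inl (Sum.inl i)) F) (by
        rw [aeval_rename]; exact hy F hF)
      rwa [eval₂_rename] at this
    have e2 : ∀ F ∈ J, eval₂ ε (fun i => z' (.inl (.inr i))) F = 0 := by
      intro F hF
      have := hz' (rename (fun i => Sum.inl (Sum.inr i)) F) (by
        rw [aeval_rename]; exact hτA F hF)
      rwa [eval₂_rename] at this
    have e3 := congrFun (huniq ε hε _ _ e1 e2) j
    have e4 := hz' ((X (.inl (.inl j)) - X (.inl (.inr j))) * X (.inr ()) - 1) (by
      simp only [map_sub, map_mul, aeval_X, map_one, z, Sum.elim_inl, Sum.elim_inr]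
      rw [mul_inv_cancel₀, sub_self]
      rw [sub_ne_zero]
      rw [hτ]
      exact hne)
    simp only [eval₂_sub, eval₂_mul, eval₂_X, eval₂_one] at e4
    rw [e3] at e4
    simp at e4
  choose b hb using fun j => Algebra.mem_bot.1 (hbot j)
  refine ⟨b, fun F hF => (algebraMap L Ω).injective ?_⟩
  rw [map_zero, ← hy F hF, ← aeval_algebraMap_apply]
  congr 2
  funext j
  exact hb j

end Algebra

/-! ### The affine cone over the toric variety -/

section Cone

variable {d s : ℕ}

theorem eval_smul_of_isHomogeneous {n : ℕ} {F : MvPolynomial (Fin s) ℂ} (hF : F.IsHomogeneous n)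
    (c : ℂ) (x : Fin s → ℂ) : eval (c • x) F = c ^ n * eval x F := by
  rw [eval_eq', eval_eq', Finset.mul_sum]
  refine Finset.sum_congr rfl fun e he => ?_
  have h := hF (mem_support_iff.1 he)
  rw [Finsupp.weight_apply, Finsupp.sum_fintype _ _ (by simp)] at h
  simp only [Pi.one_apply, smul_eq_mul, mul_one] at h
  simp only [Pi.smul_apply, smul_eq_mul, mul_pow, Finset.prod_mul_distrib,
    Finset.prod_pow_eq_pow_sum, h]
  ring

theorem eval_aeval {τ : Type*} (x : Fin s → ℂ) (g : τ → MvPolynomial (Fin s) ℂ)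
    (F : MvPolynomial τ ℂ) : eval x (aeval g F) = eval (fun i => eval x (g i)) F := by
  induction F using MvPolynomial.induction_on <;> simp_all

theorem eval_rep_mk_eq_zero_iff {n : ℕ} {F : MvPolynomial (Fin s) ℂ} (hF : F.IsHomogeneous n)
    (x : Fin s → ℂ) (hx : x ≠ 0) :
    eval (Projectivization.mk ℂ x hx).rep F = 0 ↔ eval x F = 0 := by
  obtain ⟨a, ha⟩ := Projectivization.exists_smul_eq_mk_rep ℂ x hx
  have ha' : (Projectivization.mk ℂ x hx).rep = (a : ℂ) • x := ha.symm
  rw [ha', eval_smul_of_isHomogeneous hF]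
  simp

/-- The point `y` lies in the affine cone over the Zariski closure of the torus orbit. -/
def InToricCone (m : Fin s → Fin d → ℤ) (w : Fin s → ℝ) (y : Fin s → ℂ) : Prop :=
  ∀ (n : ℕ) (F : MvPolynomial (Fin s) ℂ), F.IsHomogeneous n →
    (∀ t, eval (scaledMonomials m w t) F = 0) → eval y F = 0

variable {m : Fin s → Fin d → ℤ} {w : Fin s → ℝ}

theorem scaledMonomials_apply_ne_zero (hw : ∀ j, 0 < w j) (t : Fin d → ℂˣ) (j : Fin s) :
    scaledMonomials m w t j ≠ 0 :=
  mul_ne_zero (by exact_mod_cast (hw j).ne') (Units.ne_zero _)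

theorem scaledMonomials_ne_zero (hw : ∀ j, 0 < w j) (hs : 0 < s) (t : Fin d → ℂˣ) :
    scaledMonomials m w t ≠ 0 := fun h =>
  scaledMonomials_apply_ne_zero hw t ⟨0, hs⟩ (congrFun h _)

theorem inToricCone_scaledMonomials (t : Fin d → ℂˣ) :
    InToricCone m w (scaledMonomials m w t) := fun _ _ _ h => h t

theorem InToricCone.smul {y : Fin s → ℂ} (hy : InToricCone m w y) (c : ℂ) :
    InToricCone m w (c • y) := fun n F hF h => by
  rw [eval_smul_of_isHomogeneous hF, hy n F hF h, mul_zero]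

theorem scaledMonomials_mul (t t' : Fin d → ℂˣ) :
    scaledMonomials m w (t * t') =
      fun j => ((∏ i, t i ^ m j i : ℂˣ) : ℂ) * scaledMonomials m w t' j := by
  funext j
  simp only [scaledMonomials, Pi.mul_apply, mul_zpow, Finset.prod_mul_distrib, Units.val_mul]
  ring

/-- The substitution `x_j ↦ t^{m_j} x_j` preserves the forms vanishing on the orbit, because the
orbit is stable under multiplication by `t`. -/
theorem InToricCone.torus_action {y : Fin s → ℂ} (hy : InToricCone m w y) (t : Fin d → ℂˣ) :
    InToricCone m w (fun j => ((∏ i, t i ^ m j i : ℂˣ) : ℂ) * y j) := by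
  intro n F hF h
  let F' : MvPolynomial (Fin s) ℂ :=
    aeval (fun j => C ((∏ i, t i ^ m j i : ℂˣ) : ℂ) * X j) F
  have hF' : F'.IsHomogeneous n := by
    have := hF.aeval (n := 1) (fun j => C ((∏ i, t i ^ m j i : ℂˣ) : ℂ) * X j)
      (fun j => (isHomogeneous_X _ j).C_mul _)
    rwa [one_mul] at this
  have hev : ∀ x : Fin s → ℂ,
      eval x F' = eval (fun j => ((∏ i, t i ^ m j i : ℂˣ) : ℂ) * x j) F := by
    intro x
    simp only [F', eval_aeval, map_mul, eval_C, eval_X]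
  rw [← hev]
  refine hy n F' hF' fun t' => ?_
  rw [hev, ← scaledMonomials_mul]
  exact h _

/-- Removes projective representatives: vanishing of a form is unchanged by rescaling, and
coordinate sum one singles out one vector on each line. -/
theorem mem_scaledVeryAffineToric_iff (hw : ∀ j, 0 < w j) {y : Fin s → ℂ} :
    y ∈ scaledVeryAffineToric m w ↔ (∀ j, y j ≠ 0) ∧ ∑ j, y j = 1 ∧ InToricCone m w y := by
  constructor
  · rintro ⟨x, hx, hx0, hsum, rfl⟩
    have hs : 0 < s := by
      rcases Nat.eq_zero_or_pos s with rfl | h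
      · simp at hsum
      · exact h
    refine ⟨fun j => mul_ne_zero (inv_ne_zero hsum) (hx0 j), ?_, ?_⟩
    · simp only [Pi.smul_apply, smul_eq_mul, ← Finset.mul_sum]
      exact inv_mul_cancel₀ hsum
    · refine InToricCone.smul (fun n F hF h => hx n F hF ?_) _
      rintro _ ⟨t, ht, rfl⟩
      exact (eval_rep_mk_eq_zero_iff hF _ _).2 (h t)
  · rintro ⟨h0, hsum, hcone⟩
    have hs : 0 < s := by
      rcases Nat.eq_zero_or_pos s with rfl | h
      · simp at hsum
      · exact h
    have hy : y ≠ 0 := fun h => h0 ⟨0, hs⟩ (congrFun h _)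
    obtain ⟨a, ha⟩ := Projectivization.exists_smul_eq_mk_rep ℂ y hy
    have ha' : (Projectivization.mk ℂ y hy).rep = (a : ℂ) • y := ha.symm
    have hrs : ∑ k, (Projectivization.mk ℂ y hy).rep k = a := by
      simp [ha', ← Finset.mul_sum, hsum]
    refine ⟨Projectivization.mk ℂ y hy, ?_, fun j => ?_, ?_, ?_⟩
    · intro n F hF h
      rw [eval_rep_mk_eq_zero_iff hF]
      refine hcone n F hF fun t => ?_
      rw [← eval_rep_mk_eq_zero_iff hF _ (scaledMonomials_ne_zero hw hs t)]
      exact h _ ⟨t, _, rfl⟩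
    · rw [ha']
      exact mul_ne_zero a.ne_zero (h0 j)
    · rw [hrs]; exact a.ne_zero
    · rw [hrs, ha', smul_smul, inv_mul_cancel₀ a.ne_zero, one_smul]

end Cone

/-! ### Differentials of polynomials, and integer versus complex relations -/

section Tangent

variable {d s : ℕ}

theorem polyDifferential_add (F G : MvPolynomial (Fin s) ℂ) (x v : Fin s → ℂ) :
    polyDifferential (F + G) x v = polyDifferential F x v + polyDifferential G x v := by
  simp [polyDifferential, add_mul, Finset.sum_add_distrib]

theorem polyDifferential_sub (F G : MvPolynomial (Fin s) ℂ) (x v : Fin s → ℂ) :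
    polyDifferential (F - G) x v = polyDifferential F x v - polyDifferential G x v := by
  simp [polyDifferential, sub_mul, Finset.sum_sub_distrib]

theorem polyDifferential_mul (F G : MvPolynomial (Fin s) ℂ) (x v : Fin s → ℂ) :
    polyDifferential (F * G) x v =
      eval x F * polyDifferential G x v + eval x G * polyDifferential F x v := by
  simp only [polyDifferential, pderiv_mul, map_add, map_mul, Finset.mul_sum,
    ← Finset.sum_add_distrib]
  refine Finset.sum_congr rfl fun j _ => ?_
  ring

theorem polyDifferential_C (a : ℂ) (x v : Fin s → ℂ) : polyDifferential (C a) x v = 0 := by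
  simp [polyDifferential]

theorem polyDifferential_X (j : Fin s) (x v : Fin s → ℂ) : polyDifferential (X j) x v = v j := by
  simp only [polyDifferential, pderiv_X]
  rw [Finset.sum_eq_single j]
  · simp
  · intro b _ hb
    simp [hb.symm]
  · simp

theorem polyDifferential_X_pow (j : Fin s) (n : ℕ) (x v : Fin s → ℂ) (hx : x j ≠ 0) :
    polyDifferential (X j ^ n) x v = x j ^ n * (n * (v j / x j)) := by
  induction n with
  | zero => simpa using polyDifferential_C (1 : ℂ) x v
  | succ n ih =>
    rw [pow_succ, polyDifferential_mul, ih, polyDifferential_X]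
    simp only [map_pow, eval_X]
    field_simp
    push_cast
    ring

theorem polyDifferential_prod_X_pow (u : Fin s → ℕ) (x v : Fin s → ℂ) (hx : ∀ j, x j ≠ 0) :
    polyDifferential (∏ j, (X j : MvPolynomial (Fin s) ℂ) ^ u j) x v =
      (∏ j, x j ^ u j) * ∑ j, u j * (v j / x j) := by
  suffices ∀ T : Finset (Fin s),
      polyDifferential (∏ j ∈ T, (X j : MvPolynomial (Fin s) ℂ) ^ u j) x v =
      (∏ j ∈ T, x j ^ u j) * ∑ j ∈ T, u j * (v j / x j) from this _
  intro T
  induction T using Finset.cons_induction with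
  | empty => simpa using polyDifferential_C (1 : ℂ) x v
  | cons a T ha ih =>
    rw [Finset.prod_cons, polyDifferential_mul, ih, polyDifferential_X_pow a _ x v (hx a),
      Finset.prod_cons, Finset.sum_cons]
    simp only [map_pow, map_prod, eval_X]
    ring

theorem hasDerivAt_eval_comp (F : MvPolynomial (Fin s) ℂ) (γ : ℂ → Fin s → ℂ) (v : Fin s → ℂ)
    (a : ℂ) (h : ∀ j, HasDerivAt (fun ε => γ ε j) (v j) a) :
    HasDerivAt (fun ε => eval (γ ε) F) (polyDifferential F (γ a) v) a := by
  induction F using MvPolynomial.induction_on with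
  | C c => simpa [polyDifferential_C] using hasDerivAt_const a c
  | add p q hp hq => simpa [polyDifferential_add] using hp.fun_add hq
  | mul_X p j hp =>
    simp only [map_mul, eval_X, polyDifferential_mul, polyDifferential_X]
    rw [add_comm, mul_comm (γ a j)]
    exact hp.fun_mul (h j)

/-- A linear form that vanishes on the integer kernel of an integer matrix vanishes on its
complex kernel. -/
theorem sum_mul_eq_zero_of_forall_int (m : Fin s → Fin d → ℤ) (z : Fin s → ℂ)
    (h : ∀ a : Fin s → ℤ, ∑ j, a j = 0 → (∀ i, ∑ j, a j * m j i = 0) → ∑ j, (a j : ℂ) * z j = 0)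
    (a : Fin s → ℂ) (ha : ∑ j, a j = 0) (ham : ∀ i, ∑ j, a j * (m j i : ℂ) = 0) :
    ∑ j, a j * z j = 0 := by
  have hQ : ∀ q : Fin s → ℚ, ∑ j, q j = 0 → (∀ i, ∑ j, q j * (m j i : ℚ) = 0) →
      ∑ j, (q j : ℂ) * z j = 0 := by
    intro q hq hqm
    obtain ⟨⟨N, hN⟩, hNq⟩ :=
      IsLocalization.exist_integer_multiples_of_finite (nonZeroDivisors ℤ) q
    choose n hn using hNq
    have hN0 : (N : ℚ) ≠ 0 := by exact_mod_cast nonZeroDivisors.ne_zero hN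
    have hn' : ∀ j, (n j : ℚ) = N * q j := fun j => by
      have := hn j
      simpa [Submonoid.smul_def] using this
    have h0 := h n
      (by
        have : ((∑ j, n j : ℤ) : ℚ) = 0 := by
          push_cast
          simp only [hn', ← Finset.mul_sum, hq, mul_zero]
        exact_mod_cast this)
      (fun i => by
        have : ((∑ j, n j * m j i : ℤ) : ℚ) = 0 := by
          push_cast
          simp only [hn', mul_assoc, ← Finset.mul_sum, hqm, mul_zero]
        exact_mod_cast this)
    have hnC : ∀ j, (n j : ℂ) = N * q j := fun j => by exact_mod_cast congrArg ((↑) : ℚ → ℂ) (hn' j)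
    simp only [hnC, mul_assoc, ← Finset.mul_sum] at h0
    exact (mul_eq_zero.1 h0).resolve_left (by exact_mod_cast hN0)
  classical
  -- Expanding the complex coefficients in a basis of `ℂ` over `ℚ` splits a complex relation into
  -- rational ones, since the entries of the matrix are rational.
  let B := Module.Basis.ofVectorSpace ℚ ℂ
  let T := Finset.univ.biUnion fun j => (B.repr (a j)).support
  have hrep : ∀ j, a j = ∑ k ∈ T, (B.repr (a j) k : ℂ) * B k := by
    intro j
    conv_lhs => rw [← B.linearCombination_repr (a j), Finsupp.linearCombination_apply]
    rw [Finsupp.sum_of_support_subset _ (s := T)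
      (Finset.subset_biUnion_of_mem (fun j => (B.repr (a j)).support) (Finset.mem_univ j))
      _ (by simp)]
    simp [Algebra.smul_def]
  have hk : ∀ k, ∑ j, (B.repr (a j) k : ℂ) * z j = 0 := by
    intro k
    apply hQ (fun j => B.repr (a j) k)
    · have := congrArg (fun x => B.repr x k) ha
      simpa using this
    · intro i
      have := congrArg (fun x => B.repr x k) (ham i)
      have h2 : ∀ j, a j * (m j i : ℂ) = (m j i : ℚ) • a j := fun j => by
        rw [Algebra.smul_def, mul_comm]; simp
      simp only [h2] at this
      simpa [mul_comm] using this
  calc ∑ j, a j * z j = ∑ j, ∑ k ∈ T, B k * ((B.repr (a j) k : ℂ) * z j) := by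
        refine Finset.sum_congr rfl fun j _ => ?_
        conv_lhs => rw [hrep j, Finset.sum_mul]
        refine Finset.sum_congr rfl fun k _ => ?_
        ring
    _ = ∑ k ∈ T, B k * ∑ j, (B.repr (a j) k : ℂ) * z j := by
        rw [Finset.sum_comm]
        simp only [Finset.mul_sum]
    _ = 0 := by simp [hk]

end Tangent

/-! ### Critical points are fibres of the moment map -/

section Critical

variable {d s : ℕ} {m : Fin s → Fin d → ℤ} {w : Fin s → ℝ}

/-- The linear map sending `y` to `∑ y_j m_j`. -/
def moment (m : Fin s → Fin d → ℤ) (y : Fin s → ℂ) : Fin d → ℂ := fun i => ∑ j, y j * (m j i : ℂ)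

theorem moment_smul (c : ℂ) (y : Fin s → ℂ) : moment m (c • y) = c • moment m y := by
  funext i
  simp [moment, Finset.mul_sum, mul_assoc]

theorem IsTangentAt.sum_eq_zero (hw : ∀ j, 0 < w j) {y v : Fin s → ℂ}
    (hv : IsTangentAt (scaledVeryAffineToric m w) y v) : ∑ j, v j = 0 := by
  have := hv (∑ j, X j - C 1) (fun y' hy' => by
    simp [((mem_scaledVeryAffineToric_iff hw).1 hy').2.1])
  rw [polyDifferential_sub, polyDifferential_C, sub_zero] at this
  simp only [polyDifferential, map_sum] at this
  rw [← this]
  refine Finset.sum_congr rfl fun j _ => ?_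
  simp [pderiv_X, Pi.single_apply]

theorem prod_zpow_eq_zpow_sum {G ι : Type*} [CommGroup G] (g : G) (T : Finset ι) (e : ι → ℤ) :
    ∏ j ∈ T, g ^ e j = g ^ ∑ j ∈ T, e j := by
  induction T using Finset.cons_induction with
  | empty => simp
  | cons a T ha ih => rw [Finset.prod_cons, Finset.sum_cons, zpow_add, ih]

theorem prod_zpow_scaledMonomials (hw : ∀ j, 0 < w j) (t : Fin d → ℂˣ) (a : Fin s → ℤ)
    (ham : ∀ i, ∑ j, a j * m j i = 0) :
    ∏ j, (scaledMonomials m w t j / w j) ^ a j = 1 := by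
  have h1 : ∀ j, scaledMonomials m w t j / w j = ((∏ i, t i ^ m j i : ℂˣ) : ℂ) := fun j => by
    have : (w j : ℂ) ≠ 0 := by exact_mod_cast (hw j).ne'
    simp only [scaledMonomials]
    field_simp
  simp only [h1, ← Units.val_zpow_eq_zpow_val]
  rw [← Units.coe_prod, Units.val_eq_one]
  simp only [← Finset.prod_zpow, ← zpow_mul]
  rw [Finset.prod_comm]
  refine Finset.prod_eq_one fun i _ => ?_
  rw [prod_zpow_eq_zpow_sum]
  rw [show ∑ j, m j i * a j = 0 by rw [← ham i]; exact Finset.sum_congr rfl fun j _ => mul_comm _ _]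
  exact zpow_zero _

/-- The homogeneous binomial equation of the toric variety attached to an affine relation. -/
noncomputable def toricBinomial (w : Fin s → ℝ) (a : Fin s → ℤ) : MvPolynomial (Fin s) ℂ :=
  C (∏ j, (w j : ℂ) ^ (-a j).toNat) * ∏ j, X j ^ (a j).toNat -
    C (∏ j, (w j : ℂ) ^ (a j).toNat) * ∏ j, X j ^ (-a j).toNat

theorem isHomogeneous_toricBinomial (a : Fin s → ℤ) (ha : ∑ j, a j = 0) :
    (toricBinomial w a).IsHomogeneous (∑ j, (a j).toNat) := by
  have h : ∑ j, (-a j).toNat = ∑ j, (a j).toNat := by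
    zify
    rw [← sub_eq_zero, ← Finset.sum_sub_distrib, ← neg_eq_zero, ← Finset.sum_neg_distrib, ← ha]
    refine Finset.sum_congr rfl fun j _ => ?_
    omega
  have hp : ∀ e : Fin s → ℕ,
      (∏ j, X j ^ e j : MvPolynomial (Fin s) ℂ).IsHomogeneous (∑ j, e j) := fun e =>
    IsHomogeneous.prod _ _ _ fun j _ => isHomogeneous_X_pow j (e j)
  refine IsHomogeneous.sub ((hp _).C_mul _) ?_
  rw [← h]
  exact (hp _).C_mul _

theorem eval_toricBinomial_eq_zero_iff (hw : ∀ j, 0 < w j) (a : Fin s → ℤ) {y : Fin s → ℂ}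
    (hy : ∀ j, y j ≠ 0) :
    eval y (toricBinomial w a) = 0 ↔ ∏ j, (y j / w j) ^ a j = 1 := by
  have hw' : ∀ j, (w j : ℂ) ≠ 0 := fun j => by exact_mod_cast (hw j).ne'
  have h1 : ∀ (x : Fin s → ℂ), (∀ j, x j ≠ 0) →
      ∏ j, x j ^ a j = (∏ j, x j ^ (a j).toNat) / ∏ j, x j ^ (-a j).toNat := by
    intro x hx
    rw [← Finset.prod_div_distrib]
    refine Finset.prod_congr rfl fun j _ => ?_
    rw [← zpow_natCast, ← zpow_natCast, ← zpow_sub₀ (hx j)]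
    congr 1
    omega
  have hne : ∀ (x : Fin s → ℂ) (e : Fin s → ℕ), (∀ j, x j ≠ 0) → ∏ j, x j ^ e j ≠ 0 :=
    fun x e hx => Finset.prod_ne_zero_iff.2 fun j _ => pow_ne_zero _ (hx j)
  simp only [div_zpow, Finset.prod_div_distrib]
  rw [h1 y hy, h1 _ hw', toricBinomial]
  simp only [map_sub, map_mul, eval_C, map_prod, map_pow, eval_X]
  have n1 := hne y (fun j => (-a j).toNat) hy
  have n2 := hne (fun j => (w j : ℂ)) (fun j => (-a j).toNat) hw'
  have n3 := hne (fun j => (w j : ℂ)) (fun j => (a j).toNat) hw'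
  rw [div_div_div_eq, div_eq_one_iff_eq (mul_ne_zero n1 n3), sub_eq_zero]
  constructor <;> intro h <;> linear_combination h

theorem eval_toricBinomial_of_inToricCone (hw : ∀ j, 0 < w j) (a : Fin s → ℤ) (ha : ∑ j, a j = 0)
    (ham : ∀ i, ∑ j, a j * m j i = 0) {y : Fin s → ℂ} (hy : InToricCone m w y) :
    eval y (toricBinomial w a) = 0 :=
  hy _ _ (isHomogeneous_toricBinomial a ha) fun t =>
    (eval_toricBinomial_eq_zero_iff hw a (scaledMonomials_apply_ne_zero hw t)).2
      (prod_zpow_scaledMonomials hw t a ham)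

/-- Logarithmic differentiation of the binomial equation attached to `a`. This bounds the tangent
space from above; `isTangentAt_torus_direction` bounds it from below, and together they suffice
without computing it. -/
theorem IsTangentAt.sum_int_mul_div_eq_zero (hw : ∀ j, 0 < w j) {y v : Fin s → ℂ}
    (hy : y ∈ scaledVeryAffineToric m w)
    (hv : IsTangentAt (scaledVeryAffineToric m w) y v) (a : Fin s → ℤ) (ha : ∑ j, a j = 0)
    (ham : ∀ i, ∑ j, a j * m j i = 0) : ∑ j, (a j : ℂ) * (v j / y j) = 0 := by
  have hw' : ∀ j, (w j : ℂ) ≠ 0 := fun j => by exact_mod_cast (hw j).ne'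
  obtain ⟨hy0, -, hyc⟩ := (mem_scaledVeryAffineToric_iff hw).1 hy
  have h1 := hv (toricBinomial w a) fun y' hy' =>
    eval_toricBinomial_of_inToricCone hw a ha ham ((mem_scaledVeryAffineToric_iff hw).1 hy').2.2
  have h2 := eval_toricBinomial_of_inToricCone hw a ha ham hyc
  rw [toricBinomial] at h1 h2
  simp only [map_sub, map_mul, eval_C, map_prod, map_pow, eval_X] at h2
  rw [polyDifferential_sub, polyDifferential_mul, polyDifferential_mul, polyDifferential_C,
    polyDifferential_C, polyDifferential_prod_X_pow _ _ _ hy0,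
    polyDifferential_prod_X_pow _ _ _ hy0] at h1
  simp only [eval_C, mul_zero, add_zero] at h1
  have hne : (∏ j, (w j : ℂ) ^ (-a j).toNat) * ∏ j, y j ^ (a j).toNat ≠ 0 :=
    mul_ne_zero (Finset.prod_ne_zero_iff.2 fun j _ => pow_ne_zero _ (hw' j))
      (Finset.prod_ne_zero_iff.2 fun j _ => pow_ne_zero _ (hy0 j))
  apply (mul_eq_zero.1 (?_ : ((∏ j, (w j : ℂ) ^ (-a j).toNat) * ∏ j, y j ^ (a j).toNat) *
    -- The two monomial terms of the binomial agree at `y` and are nonzero, so a common factor can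
    -- be cancelled.
    ∑ j, (a j : ℂ) * (v j / y j) = 0)).resolve_left hne
  have h3 : ∑ j, (a j : ℂ) * (v j / y j) =
      ∑ j, ((a j).toNat : ℂ) * (v j / y j) - ∑ j, ((-a j).toNat : ℂ) * (v j / y j) := by
    rw [← Finset.sum_sub_distrib]
    refine Finset.sum_congr rfl fun j _ => ?_
    rw [← sub_mul]
    congr 1
    have : a j = ((a j).toNat : ℤ) - ((-a j).toNat : ℤ) := by omega
    exact_mod_cast congrArg ((↑) : ℤ → ℂ) this
  rw [h3]
  linear_combination h1 - (∑ j, ((-a j).toNat : ℂ) * (v j / y j)) * h2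

/-- The vector is the velocity at 0 of the curve obtained by moving `y` with the one-parameter
subgroup `exp(ε)` in the `i`-th torus coordinate and renormalizing the coordinate sum to one. -/
theorem isTangentAt_torus_direction (hw : ∀ j, 0 < w j) {y : Fin s → ℂ}
    (hy : y ∈ scaledVeryAffineToric m w) (i : Fin d) :
    IsTangentAt (scaledVeryAffineToric m w) y (fun j => y j * ((m j i : ℂ) - moment m y i)) := by
  intro F hF
  obtain ⟨hy0, hsum, hyc⟩ := (mem_scaledVeryAffineToric_iff hw).1 hy
  let S : ℂ → ℂ := fun ε => ∑ k, Complex.exp (ε * m k i) * y k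
  let γ : ℂ → Fin s → ℂ := fun ε j => Complex.exp (ε * m j i) * y j / S ε
  have hE : ∀ j, HasDerivAt (fun ε : ℂ => Complex.exp (ε * m j i) * y j) ((m j i : ℂ) * y j) 0 := by
    intro j
    have h1 : HasDerivAt (fun ε : ℂ => ε * (m j i : ℂ)) (m j i : ℂ) 0 := by
      simpa using (hasDerivAt_id (0 : ℂ)).mul_const (m j i : ℂ)
    simpa using (h1.cexp).mul_const (y j)
  have hS0 : S 0 = 1 := by simp [S, hsum]
  have hS : HasDerivAt S (moment m y i) 0 := by
    have := HasDerivAt.fun_sum (u := Finset.univ) fun j _ => hE j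
    have e : moment m y i = ∑ j, (m j i : ℂ) * y j := by simp [moment, mul_comm]
    rw [e]
    exact this
  have hγ0 : γ 0 = y := by
    funext j
    simp [γ, hS0]
  have hγ : ∀ j, HasDerivAt (fun ε => γ ε j) (y j * ((m j i : ℂ) - moment m y i)) 0 := by
    intro j
    have := (hE j).fun_div hS (by rw [hS0]; exact one_ne_zero)
    have e : y j * ((m j i : ℂ) - moment m y i) =
        ((m j i : ℂ) * y j * S 0 - Complex.exp (0 * m j i) * y j * moment m y i) / S 0 ^ 2 := by
      rw [hS0]
      simp
      ring
    rw [e]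
    exact this
  have hmem : ∀ᶠ ε in nhds 0, γ ε ∈ scaledVeryAffineToric m w := by
    have hne : ∀ᶠ ε in nhds 0, S ε ≠ 0 :=
      hS.continuousAt.eventually_ne (by rw [hS0]; exact one_ne_zero)
    filter_upwards [hne] with ε hε
    rw [mem_scaledVeryAffineToric_iff hw]
    refine ⟨fun j => div_ne_zero (mul_ne_zero (Complex.exp_ne_zero _) (hy0 j)) hε, ?_, ?_⟩
    · simp only [γ, ← Finset.sum_div]
      exact div_self hε
    · let t : Fin d → ℂˣ := Function.update 1 i (Units.mk0 _ (Complex.exp_ne_zero ε))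
      have ht : ∀ j, ((∏ l, t l ^ m j l : ℂˣ) : ℂ) = Complex.exp (ε * m j i) := by
        intro j
        rw [Finset.prod_eq_single i]
        · simp [t, ← Complex.exp_int_mul, mul_comm]
        · intro l _ hl
          simp [t, Function.update_of_ne hl]
        · simp
      have h1 := (hyc.torus_action t).smul (S ε)⁻¹
      convert h1 using 1
      funext j
      simp only [γ, Pi.smul_apply, smul_eq_mul, ht]
      rw [div_eq_inv_mul]
  have h1 := hasDerivAt_eval_comp F γ _ 0 hγ
  rw [hγ0] at h1
  have h2 : (fun ε => eval (γ ε) F) =ᶠ[nhds 0] fun _ => 0 := by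
    filter_upwards [hmem] with ε hε using hF _ hε
  exact (h1.congr_of_eventuallyEq h2.symm).unique (hasDerivAt_const 0 (0 : ℂ))

/-- The critical points of the likelihood function are the points of the fibre of the moment map
over the normalized data. -/
theorem mem_likelihoodCriticalPoints_iff (hw : ∀ j, 0 < w j) (u : Fin s → ℕ) {y : Fin s → ℂ} :
    y ∈ likelihoodCriticalPoints (scaledVeryAffineToric m w) u ↔
      y ∈ scaledVeryAffineToric m w ∧
        (∑ j, (u j : ℂ)) • moment m y = moment m (fun j => (u j : ℂ)) := by
  refine and_congr_right fun hy => ?_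
  obtain ⟨hy0, hsum, hyc⟩ := (mem_scaledVeryAffineToric_iff hw).1 hy
  have hprod : ∏ j, y j ^ u j ≠ 0 := Finset.prod_ne_zero_iff.2 fun j _ => pow_ne_zero _ (hy0 j)
  simp only [polyDifferential_prod_X_pow u y _ hy0, mul_eq_zero, hprod, false_or]
  constructor
  · intro h
    funext i
    have := h _ (isTangentAt_torus_direction hw hy i)
    have h2 : ∀ j, (u j : ℂ) * (y j * ((m j i : ℂ) - moment m y i) / y j) =
        u j * (m j i : ℂ) - u j * moment m y i := fun j => by
      have := hy0 j
      field_simp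
    simp only [h2, Finset.sum_sub_distrib, ← Finset.sum_mul] at this
    simp only [Pi.smul_apply, smul_eq_mul]
    rw [← sub_eq_zero.1 this, moment]
  · intro h v hv
    -- The moment condition says that `u - (∑ u_k) y` is an affine relation among the `m_j`. It
    -- therefore annihilates `v / y`; the `y` part contributes a multiple of `∑ v_j = 0`.
    have h0 := sum_mul_eq_zero_of_forall_int m (fun j => v j / y j)
      (fun a ha ham => hv.sum_int_mul_div_eq_zero hw hy a ha ham)
      (fun j => u j - (∑ k, (u k : ℂ)) * y j)
      (by simp [Finset.sum_sub_distrib, ← Finset.mul_sum, hsum])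
      (fun i => by
        have := congrFun h i
        simp only [moment, Pi.smul_apply, smul_eq_mul, Finset.mul_sum] at this
        simp only [sub_mul, Finset.sum_sub_distrib, mul_assoc]
        rw [sub_eq_zero, this])
    have h1 : ∀ j, (u j - (∑ k, (u k : ℂ)) * y j) * (v j / y j) =
        u j * (v j / y j) - (∑ k, (u k : ℂ)) * v j := fun j => by
      have := hy0 j
      field_simp
    simp only [h1, Finset.sum_sub_distrib, ← Finset.mul_sum, hv.sum_eq_zero hw, mul_zero,
      sub_zero] at h0
    exact h0

end Critical

/-! ### Birch's theorem: inverting the moment map on the polytope -/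

section Birch

variable {d s : ℕ}

/-- The convex combination map of the lattice points, as a linear map. -/
def realMoment (m : Fin s → Fin d → ℤ) : (Fin s → ℝ) →ₗ[ℝ] (Fin d → ℝ) :=
  ∑ j, (LinearMap.proj j : (Fin s → ℝ) →ₗ[ℝ] ℝ).smulRight (latticeToReal (m j))

theorem realMoment_apply (m : Fin s → Fin d → ℤ) (y : Fin s → ℝ) :
    realMoment m y = ∑ j, y j • latticeToReal (m j) := by
  simp [realMoment]

theorem realMoment_apply_apply (m : Fin s → Fin d → ℤ) (y : Fin s → ℝ) (i : Fin d) :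
    realMoment m y i = ∑ j, y j * (m j i : ℝ) := by
  simp [realMoment_apply, latticeToReal, Finset.sum_apply]

theorem continuous_realMoment (m : Fin s → Fin d → ℤ) : Continuous (realMoment m) :=
  LinearMap.continuous_of_finiteDimensional _

theorem realMoment_single (m : Fin s → Fin d → ℤ) (j : Fin s) :
    realMoment m (Pi.single j 1) = latticeToReal (m j) := by
  rw [realMoment_apply, Finset.sum_eq_single j]
  · simp
  · intro b _ hb
    simp [hb]
  · simp

theorem eq_realMoment_image_stdSimplex {P : Set (Fin d → ℝ)} (hP : IsLatticePolytope P)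
    {m : Fin s → Fin d → ℤ} (hm : EnumeratesLatticePoints P m) :
    P = realMoment m '' stdSimplex ℝ (Fin s) := by
  obtain ⟨V, hV⟩ := hP
  have hconv : Convex ℝ P := hV ▸ convex_convexHull _ _
  have hmem : ∀ j, latticeToReal (m j) ∈ P := fun j => by
    have : m j ∈ Set.range m := ⟨j, rfl⟩
    rwa [hm.2] at this
  apply Set.Subset.antisymm
  · conv_lhs => rw [hV]
    refine convexHull_min ?_ ((convex_stdSimplex ℝ (Fin s)).linear_image _)
    rintro _ ⟨a, ha, rfl⟩
    have : a ∈ Set.range m := by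
      rw [hm.2]
      change latticeToReal a ∈ P
      rw [hV]
      exact subset_convexHull _ _ ⟨a, ha, rfl⟩
    obtain ⟨j, rfl⟩ := this
    exact ⟨_, single_mem_stdSimplex ℝ j, realMoment_single m j⟩
  · rintro _ ⟨c, hc, rfl⟩
    rw [realMoment_apply]
    exact hconv.sum_mem (fun j _ => hc.1 j) hc.2 fun j _ => hmem j

/-- The positive real point of the toric variety with logarithmic coordinates `θ`, normalized
to coordinate sum one. -/
noncomputable def gibbsPoint (m : Fin s → Fin d → ℤ) (w : Fin s → ℝ) (θ : Fin d → ℝ) :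
    Fin s → ℝ :=
  fun j => w j * Real.exp (∑ i, (m j i : ℝ) * θ i) / ∑ k, w k * Real.exp (∑ i, (m k i : ℝ) * θ i)

variable {m : Fin s → Fin d → ℤ} {w : Fin s → ℝ}

theorem gibbs_denominator_pos (hw : ∀ j, 0 < w j) (hs : 0 < s) (θ : Fin d → ℝ) :
    0 < ∑ k, w k * Real.exp (∑ i, (m k i : ℝ) * θ i) :=
  Finset.sum_pos (fun k _ => mul_pos (hw k) (Real.exp_pos _)) ⟨⟨0, hs⟩, Finset.mem_univ _⟩

theorem gibbsPoint_pos (hw : ∀ j, 0 < w j) (hs : 0 < s) (θ : Fin d → ℝ) (j : Fin s) :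
    0 < gibbsPoint m w θ j :=
  div_pos (mul_pos (hw j) (Real.exp_pos _)) (gibbs_denominator_pos hw hs θ)

theorem sum_gibbsPoint (hw : ∀ j, 0 < w j) (hs : 0 < s) (θ : Fin d → ℝ) :
    ∑ j, gibbsPoint m w θ j = 1 := by
  simp only [gibbsPoint, ← Finset.sum_div]
  exact div_self (gibbs_denominator_pos hw hs θ).ne'

theorem gibbsPoint_mem_stdSimplex (hw : ∀ j, 0 < w j) (hs : 0 < s) (θ : Fin d → ℝ) :
    gibbsPoint m w θ ∈ stdSimplex ℝ (Fin s) :=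
  ⟨fun j => (gibbsPoint_pos hw hs θ j).le, sum_gibbsPoint hw hs θ⟩

/-- The partition function centred at an interior point of the polytope is coercive. -/
theorem tendsto_partition_function {P : Set (Fin d → ℝ)}
    (hP : P = realMoment m '' stdSimplex ℝ (Fin s)) (hw : ∀ j, 0 < w j) (hs : 0 < s)
    {p : Fin d → ℝ} (hp : p ∈ interior P) :
    Filter.Tendsto (fun θ : Fin d → ℝ => ∑ j, w j * Real.exp (∑ i, ((m j i : ℝ) - p i) * θ i))
      (Filter.cocompact _) Filter.atTop := by
  obtain ⟨r, hr, hball⟩ := Metric.nhds_basis_closedBall.mem_iff.1 (mem_interior_iff_mem_nhds.1 hp)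
  obtain ⟨j₀, -, hj₀⟩ := Finset.exists_min_image Finset.univ w ⟨⟨0, hs⟩, Finset.mem_univ _⟩
  have key : ∀ θ : Fin d → ℝ, w j₀ * (r * ‖θ‖) ≤
      ∑ j, w j * Real.exp (∑ i, ((m j i : ℝ) - p i) * θ i) := by
    intro θ
    -- In the sup norm, `p + r · sign θ` stays in the ball of radius `r`. As a convex combination of
    -- the `m_j` it gives the exponents the weighted mean `r ∑ |θ_i| ≥ r ‖θ‖`, so some exponent is
    -- at least that large.
    let v : Fin d → ℝ := fun i => r * SignType.sign (θ i)
    have hv : p + v ∈ P := by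
      apply hball
      rw [Metric.mem_closedBall, dist_eq_norm, add_sub_cancel_left, pi_norm_le_iff_of_nonneg hr.le]
      intro i
      rw [Real.norm_eq_abs, abs_mul, abs_of_pos hr]
      refine mul_le_of_le_one_right hr.le ?_
      rcases lt_trichotomy (θ i) 0 with h | h | h <;> simp [h]
    rw [hP] at hv
    obtain ⟨c, hc, hcv⟩ := hv
    have h1 : ∑ j, c j * (∑ i, ((m j i : ℝ) - p i) * θ i) = r * ∑ i, |θ i| := by
      simp only [Finset.mul_sum]
      rw [Finset.sum_comm]
      refine Finset.sum_congr rfl fun i _ => ?_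
      have h2 := congrFun hcv i
      rw [realMoment_apply_apply] at h2
      have h3 : ∑ j, c j * (((m j i : ℝ) - p i) * θ i) =
          (∑ j, c j * (m j i : ℝ) - (∑ j, c j) * p i) * θ i := by
        rw [Finset.sum_mul, ← Finset.sum_sub_distrib, Finset.sum_mul]
        refine Finset.sum_congr rfl fun j _ => ?_
        ring
      rw [h3, h2, hc.2, ← sign_mul_self (θ i)]
      simp only [v, Pi.add_apply]
      ring
    have h4 : ‖θ‖ ≤ ∑ i, |θ i| := by
      rw [pi_norm_le_iff_of_nonneg (Finset.sum_nonneg fun i _ => abs_nonneg _)]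
      intro i
      exact Finset.single_le_sum (f := fun i => |θ i|) (fun i _ => abs_nonneg _) (Finset.mem_univ i)
    obtain ⟨j, hj⟩ : ∃ j, r * ‖θ‖ ≤ ∑ i, ((m j i : ℝ) - p i) * θ i := by
      by_contra! hcon
      have h5 : ∑ j, c j * (∑ i, ((m j i : ℝ) - p i) * θ i) < ∑ j, c j * (r * ‖θ‖) := by
        obtain ⟨k, hk⟩ : ∃ k, 0 < c k := by
          by_contra! h
          have := Finset.sum_nonpos fun k (_ : k ∈ Finset.univ) => h k
          rw [hc.2] at this
          linarith
        exact Finset.sum_lt_sum (fun j _ => mul_le_mul_of_nonneg_left (hcon j).le (hc.1 j))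
          ⟨k, Finset.mem_univ _, mul_lt_mul_of_pos_left (hcon k) hk⟩
      rw [h1, ← Finset.sum_mul, hc.2, one_mul] at h5
      exact absurd (mul_le_mul_of_nonneg_left h4 hr.le) (not_le.2 h5)
    calc w j₀ * (r * ‖θ‖) ≤ w j * Real.exp (∑ i, ((m j i : ℝ) - p i) * θ i) := by
          refine mul_le_mul (hj₀ j (Finset.mem_univ _)) (hj.trans ?_)
            (mul_nonneg hr.le (norm_nonneg _)) (hw j).le
          linarith [Real.add_one_le_exp (∑ i, ((m j i : ℝ) - p i) * θ i)]
      _ ≤ _ := Finset.single_le_sum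
          (f := fun j => w j * Real.exp (∑ i, ((m j i : ℝ) - p i) * θ i))
          (fun k _ => (mul_pos (hw k) (Real.exp_pos _)).le) (Finset.mem_univ j)
  refine Filter.tendsto_atTop_mono key ?_
  exact (tendsto_norm_cocompact_atTop.const_mul_atTop hr).const_mul_atTop (hw j₀)

/-- Every interior point of the polytope is the moment of a positive point of the toric variety. -/
theorem exists_realMoment_gibbsPoint_eq {P : Set (Fin d → ℝ)}
    (hP : P = realMoment m '' stdSimplex ℝ (Fin s)) (hw : ∀ j, 0 < w j) (hs : 0 < s)
    {p : Fin d → ℝ} (hp : p ∈ interior P) : ∃ θ, realMoment m (gibbsPoint m w θ) = p := by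
  -- The minimizer of the partition function centred at `p`: its vanishing gradient is, up to the
  -- factor `exp ⟨p, θ⟩`, the moment equation.
  obtain ⟨θ, hθ⟩ := Continuous.exists_forall_le (by fun_prop) (tendsto_partition_function hP hw hs hp)
  refine ⟨θ, ?_⟩
  have hcrit : ∀ i, ∑ j, w j * (Real.exp (∑ l, ((m j l : ℝ) - p l) * θ l) * ((m j i : ℝ) - p i)) =
      0 := by
    intro i
    have hmin : IsLocalMin (fun ε : ℝ => ∑ j, w j *
        Real.exp (∑ l, ((m j l : ℝ) - p l) * θ l + ε * ((m j i : ℝ) - p i))) 0 := by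
      refine Filter.Eventually.of_forall fun ε => ?_
      have := hθ (θ + ε • Pi.single i 1)
      convert this using 1
      · simp
      · refine Finset.sum_congr rfl fun j _ => ?_
        congr 2
        simp [mul_add, Finset.sum_add_distrib, Pi.single_apply, mul_comm]
    refine hmin.hasDerivAt_eq_zero ?_
    refine HasDerivAt.fun_sum fun j _ => ?_
    have h1 : HasDerivAt (fun ε : ℝ => ∑ l, ((m j l : ℝ) - p l) * θ l + ε * ((m j i : ℝ) - p i))
        ((m j i : ℝ) - p i) 0 := by
      simpa using ((hasDerivAt_id (0 : ℝ)).mul_const ((m j i : ℝ) - p i)).const_add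
        (∑ l, ((m j l : ℝ) - p l) * θ l)
    simpa using h1.exp.const_mul (w j)
  funext i
  have hS := gibbs_denominator_pos (m := m) hw hs θ
  rw [realMoment_apply_apply]
  simp only [gibbsPoint, div_mul_eq_mul_div, ← Finset.sum_div]
  rw [div_eq_iff hS.ne', ← sub_eq_zero, Finset.mul_sum, ← Finset.sum_sub_distrib]
  have h2 := congrArg (fun x => x * Real.exp (∑ l, p l * θ l)) (hcrit i)
  simp only [zero_mul, Finset.sum_mul] at h2
  rw [← h2]
  refine Finset.sum_congr rfl fun j _ => ?_
  have h3 : Real.exp (∑ l, (m j l : ℝ) * θ l) =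
      Real.exp (∑ l, ((m j l : ℝ) - p l) * θ l) * Real.exp (∑ l, p l * θ l) := by
    rw [← Real.exp_add, ← Finset.sum_add_distrib]
    congr 1
    exact Finset.sum_congr rfl fun l _ => by ring
  rw [h3]
  ring

/-- The points of the standard simplex that satisfy all binomial equations with real exponents. -/
def nonnegToric (m : Fin s → Fin d → ℤ) (w : Fin s → ℝ) : Set (Fin s → ℝ) :=
  {y | y ∈ stdSimplex ℝ (Fin s) ∧ ∀ a : Fin s → ℝ, ∑ j, a j = 0 → realMoment m a = 0 →
    ∏ j, (y j / w j) ^ max (a j) 0 = ∏ j, (y j / w j) ^ max (-a j) 0}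

/-- The exponents `max (±a) 0` are nonnegative, so the equations stay continuous at points with zero
coordinates and cut out a closed part of the simplex. -/
theorem isCompact_nonnegToric : IsCompact (nonnegToric m w) := by
  refine (isCompact_stdSimplex ℝ (Fin s)).of_isClosed_subset ?_ fun y hy => hy.1
  have h : nonnegToric m w = stdSimplex ℝ (Fin s) ∩ ⋂ (a : Fin s → ℝ) (_ : ∑ j, a j = 0)
      (_ : realMoment m a = 0),
      {y | ∏ j, (y j / w j) ^ max (a j) 0 = ∏ j, (y j / w j) ^ max (-a j) 0} := by
    ext y
    simp [nonnegToric]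
  rw [h]
  refine (isClosed_stdSimplex ℝ (Fin s)).inter (isClosed_iInter fun a => isClosed_iInter fun _ =>
    isClosed_iInter fun _ => isClosed_eq ?_ ?_) <;>
  exact continuous_finsetProd _ fun j _ => ((continuous_apply j).div_const _).rpow_const
    fun _ => Or.inr (le_max_right _ _)

theorem gibbsPoint_mem_nonnegToric (hw : ∀ j, 0 < w j) (hs : 0 < s) (θ : Fin d → ℝ) :
    gibbsPoint m w θ ∈ nonnegToric m w := by
  refine ⟨gibbsPoint_mem_stdSimplex hw hs θ, fun a ha ham => ?_⟩
  have hS := gibbs_denominator_pos (m := m) hw hs θ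
  set S := ∑ k, w k * Real.exp (∑ i, (m k i : ℝ) * θ i) with hSdef
  have h1 : ∀ j, gibbsPoint m w θ j / w j =
      Real.exp (∑ i, (m j i : ℝ) * θ i - Real.log S) := fun j => by
    have := (hw j).ne'
    rw [Real.exp_sub, Real.exp_log hS, gibbsPoint, ← hSdef]
    field_simp
  simp only [h1, ← Real.exp_mul, ← Real.exp_sum]
  congr 1
  rw [← sub_eq_zero, ← Finset.sum_sub_distrib]
  have h2 : ∀ j, (∑ i, (m j i : ℝ) * θ i - Real.log S) * max (a j) 0 -
      (∑ i, (m j i : ℝ) * θ i - Real.log S) * max (-a j) 0 =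
      ∑ i, θ i * (a j * (m j i : ℝ)) - Real.log S * a j := fun j => by
    have h3 : max (a j) 0 - max (-a j) 0 = a j := by
      rcases le_total (a j) 0 with h | h
      · rw [max_eq_right h, max_eq_left (by linarith)]; ring
      · rw [max_eq_left h, max_eq_right (by linarith)]; ring
    rw [← mul_sub, h3, sub_mul, Finset.sum_mul]
    congr 1
    exact Finset.sum_congr rfl fun i _ => by ring
  simp only [h2, Finset.sum_sub_distrib, ← Finset.mul_sum, ha]
  rw [Finset.sum_comm]
  have h4 : ∀ i, ∑ j, a j * (m j i : ℝ) = 0 := fun i => by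
    rw [← realMoment_apply_apply, ham]; rfl
  simp [← Finset.mul_sum, h4]

/-- For two points with equal moments, `a = y - y'` is itself an admissible exponent vector, which
is why real exponents are allowed. Passing from `y'` to `y` strictly increases the left side of its
equation and does not increase the right side. This argument also covers zero coordinates, where
logarithms are unavailable. -/
theorem injOn_realMoment_nonnegToric (hw : ∀ j, 0 < w j) :
    Set.InjOn (realMoment m) (nonnegToric m w) := by
  intro y hy y' hy' heq
  by_contra hne
  let a : Fin s → ℝ := y - y'
  have ha : ∑ j, a j = 0 := by simp [a, Finset.sum_sub_distrib, hy.1.2, hy'.1.2]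
  have ham : realMoment m a = 0 := by simp [a, heq]
  obtain ⟨k, hk⟩ : ∃ k, 0 < a k := by
    by_contra! hcon
    have h0 := (Finset.sum_eq_zero_iff_of_nonpos fun j _ => hcon j).1 ha
    apply hne
    funext j
    exact sub_eq_zero.1 (h0 j (Finset.mem_univ j))
  have e1 := hy.2 a ha ham
  have e2 := hy'.2 a ha ham
  have hq : ∀ j, 0 ≤ y j / w j := fun j => div_nonneg (hy.1.1 j) (hw j).le
  have hq' : ∀ j, 0 ≤ y' j / w j := fun j => div_nonneg (hy'.1.1 j) (hw j).le
  have hle : ∀ j, (y' j / w j) ^ max (a j) 0 ≤ (y j / w j) ^ max (a j) 0 := fun j => by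
    rcases le_total (a j) 0 with h | h
    · simp [max_eq_right h]
    · exact Real.rpow_le_rpow (hq' j)
        (div_le_div_of_nonneg_right (sub_nonneg.1 h) (hw j).le) (le_max_right _ _)
  have hle' : ∀ j, (y j / w j) ^ max (-a j) 0 ≤ (y' j / w j) ^ max (-a j) 0 := fun j => by
    rcases le_total (-a j) 0 with h | h
    · simp [max_eq_right h]
    · refine Real.rpow_le_rpow (hq j)
        (div_le_div_of_nonneg_right ?_ (hw j).le) (le_max_right _ _)
      have : a j = y j - y' j := rfl
      linarith
  have hpos' : ∀ j, 0 < (y' j / w j) ^ max (-a j) 0 := fun j => by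
    rcases le_or_gt (-a j) 0 with h | h
    · simp [max_eq_right h]
    · refine Real.rpow_pos_of_pos (div_pos ?_ (hw j)) _
      have h1 : a j = y j - y' j := rfl
      have h2 := hy.1.1 j
      linarith
  -- Strict monotonicity of the product needs all its factors at `y'` to be positive. The equation
  -- at `y'` supplies this: where `a j < 0`, `y' j` exceeds `y j ≥ 0`, so its right side is
  -- positive.
  have hE' : 0 < ∏ j, (y' j / w j) ^ max (a j) 0 := by
    rw [e2]
    exact Finset.prod_pos fun j _ => hpos' j
  have hpos : ∀ j, 0 < (y' j / w j) ^ max (a j) 0 := fun j =>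
    lt_of_le_of_ne (Real.rpow_nonneg (hq' j) _) fun h =>
      hE'.ne' (Finset.prod_eq_zero (Finset.mem_univ j) h.symm)
  have hlt : ∏ j, (y' j / w j) ^ max (a j) 0 < ∏ j, (y j / w j) ^ max (a j) 0 := by
    refine Finset.prod_lt_prod (fun j _ => hpos j) (fun j _ => hle j) ⟨k, Finset.mem_univ _, ?_⟩
    refine Real.rpow_lt_rpow (hq' k) (div_lt_div_of_pos_right (sub_pos.1 hk) (hw k)) ?_
    rw [max_eq_left hk.le]
    exact hk
  have hle2 : ∏ j, (y j / w j) ^ max (-a j) 0 ≤ ∏ j, (y' j / w j) ^ max (-a j) 0 :=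
    Finset.prod_le_prod (fun j _ => Real.rpow_nonneg (hq j) _) fun j _ => hle' j
  rw [← e1, ← e2] at hle2
  exact absurd hlt (not_lt.2 hle2)

/-- The moment map restricts to a homeomorphism from the nonnegative part of the toric variety to
the polytope; `φ` is its inverse. -/
theorem exists_continuous_moment_inverse {P : Set (Fin d → ℝ)} (hlat : IsLatticePolytope P)
    (hfull : (interior P).Nonempty) (hm : EnumeratesLatticePoints P m) (hw : ∀ j, 0 < w j)
    (hs : 0 < s) :
    ∃ φ : (Fin d → ℝ) → Fin s → ℝ, ContinuousOn φ P ∧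
      (∀ p ∈ P, φ p ∈ stdSimplex ℝ (Fin s) ∧ realMoment m (φ p) = p) ∧
      (∀ p ∈ interior P, ∃ θ, φ p = gibbsPoint m w θ) ∧
      ∀ θ, realMoment m (gibbsPoint m w θ) ∈ P ∧
        φ (realMoment m (gibbsPoint m w θ)) = gibbsPoint m w θ := by
  have hP := eq_realMoment_image_stdSimplex hlat hm
  have hconv : Convex ℝ P := by
    rw [hP]
    exact (convex_stdSimplex ℝ (Fin s)).linear_image _
  -- The image of a compact set is closed and contains the interior of `P`, hence all of `P`.
  have himage : P ⊆ realMoment m '' nonnegToric m w := by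
    have hcl : IsClosed (realMoment m '' nonnegToric m w) :=
      (isCompact_nonnegToric.image (continuous_realMoment m)).isClosed
    have h1 : interior P ⊆ realMoment m '' nonnegToric m w := fun p hp => by
      obtain ⟨θ, hθ⟩ := exists_realMoment_gibbsPoint_eq hP hw hs hp
      exact ⟨_, gibbsPoint_mem_nonnegToric hw hs θ, hθ⟩
    refine (subset_closure.trans ?_).trans (hcl.closure_subset_iff.2 h1)
    rw [hconv.closure_interior_eq_closure_of_nonempty_interior hfull]
  have hex : ∀ p, p ∈ P → ∃ y : Fin s → ℝ, y ∈ nonnegToric m w ∧ realMoment m y = p :=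
    fun p hp => himage hp
  choose! φ hφ using hex
  have hinj := injOn_realMoment_nonnegToric (m := m) hw
  have hgP : ∀ θ, realMoment m (gibbsPoint m w θ) ∈ P := fun θ => by
    rw [hP]
    exact ⟨_, gibbsPoint_mem_stdSimplex hw hs θ, rfl⟩
  have hgφ : ∀ θ, φ (realMoment m (gibbsPoint m w θ)) = gibbsPoint m w θ := fun θ =>
    hinj (hφ _ (hgP θ)).1 (gibbsPoint_mem_nonnegToric hw hs θ) (hφ _ (hgP θ)).2
  refine ⟨φ, ?_, fun p hp => ⟨(hφ p hp).1.1, (hφ p hp).2⟩, fun p hp => ?_, fun θ => ⟨hgP θ, hgφ θ⟩⟩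
  · have : CompactSpace (nonnegToric m w) := isCompact_iff_compactSpace.1 isCompact_nonnegToric
    -- A continuous injection from a compact space to a Hausdorff space is a closed embedding, so
    -- its inverse is continuous.
    have hemb : Topology.IsClosedEmbedding (fun y : nonnegToric m w => realMoment m y) :=
      ((continuous_realMoment m).comp continuous_subtype_val).isClosedEmbedding
        fun y y' h => Subtype.ext (hinj y.2 y'.2 h)
    have hg : Continuous fun p : P => (⟨φ p, (hφ p p.2).1⟩ : nonnegToric m w) := by
      rw [hemb.isInducing.continuous_iff]
      convert continuous_subtype_val (p := fun p => p ∈ P) using 1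
      funext p
      exact (hφ p p.2).2
    rw [continuousOn_iff_continuous_domRestrict]
    exact continuous_subtype_val.comp hg
  · obtain ⟨θ, hθ⟩ := exists_realMoment_gibbsPoint_eq hP hw hs hp
    exact ⟨θ, by rw [← hgφ θ, hθ]⟩

end Birch

/-! ### Homogenization relative to the slice of coordinate sum one -/

section Homogenize

variable {s : ℕ}

/-- The homogenization of a polynomial with respect to the sum of the coordinates. -/
noncomputable def homogenizeBySum (F : MvPolynomial (Fin s) ℂ) : MvPolynomial (Fin s) ℂ :=
  ∑ n ∈ Finset.range (F.totalDegree + 1),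
    homogeneousComponent n F * (∑ j, X j) ^ (F.totalDegree - n)

theorem isHomogeneous_homogenizeBySum (F : MvPolynomial (Fin s) ℂ) :
    (homogenizeBySum F).IsHomogeneous F.totalDegree := by
  refine IsHomogeneous.sum _ _ _ fun n hn => ?_
  have h1 : (∑ j, X j : MvPolynomial (Fin s) ℂ).IsHomogeneous 1 :=
    IsHomogeneous.sum _ _ _ fun j _ => isHomogeneous_X _ j
  have h2 := (homogeneousComponent_isHomogeneous n F).mul (h1.pow (F.totalDegree - n))
  have h3 : n + 1 * (F.totalDegree - n) = F.totalDegree := by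
    have := Finset.mem_range.1 hn
    omega
  rwa [h3] at h2

/-- On the slice `∑ x_j = 1` the homogenization agrees with `F`, so inhomogeneous identities there
can be tested by forms on the projective closure. -/
theorem eval_homogenizeBySum (F : MvPolynomial (Fin s) ℂ) (x : Fin s → ℂ) (hx : ∑ j, x j ≠ 0) :
    eval x (homogenizeBySum F) =
      (∑ j, x j) ^ F.totalDegree * eval ((∑ j, x j)⁻¹ • x) F := by
  have e : eval ((∑ j, x j)⁻¹ • x) F = ∑ n ∈ Finset.range (F.totalDegree + 1),
      eval ((∑ j, x j)⁻¹ • x) (homogeneousComponent n F) := by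
    rw [← map_sum, sum_homogeneousComponent]
  rw [e]
  simp only [homogenizeBySum, map_sum, map_mul, map_pow, eval_X, Finset.mul_sum]
  refine Finset.sum_congr rfl fun n hn => ?_
  rw [eval_smul_of_isHomogeneous (homogeneousComponent_isHomogeneous n F)]
  have h : F.totalDegree = n + (F.totalDegree - n) := by
    have := Finset.mem_range.1 hn
    omega
  conv_rhs => rw [h]
  rw [pow_add, inv_pow]
  field_simp

end Homogenize

/-! ### Density of generic data and of nonvanishing loci -/

section Density

variable {d s : ℕ} {m : Fin s → Fin d → ℤ}

/-- Just above `N c`, a grid with more integers per coordinate than the degree of `G` contains a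
point where `G ≠ 0`. The grid size does not depend on `N`, so the error disappears after division by
`N`. -/
theorem exists_nat_approximation (G : MvPolynomial (Fin s) ℂ) (hG : G ≠ 0) (c : Fin s → ℝ)
    (hc : ∀ j, 0 ≤ c j) :
    ∃ u : ℕ → Fin s → ℕ, (∀ N j, 0 < u N j) ∧ (∀ N, eval (fun j => (u N j : ℂ)) G ≠ 0) ∧
      Filter.Tendsto (fun (N : ℕ) (j : Fin s) => (u N j : ℝ) / N) Filter.atTop (nhds c) := by
  have hex : ∀ N : ℕ, ∃ v : Fin s → ℕ,
      (∀ j, ⌊N * c j⌋₊ < v j ∧ v j ≤ ⌊N * c j⌋₊ + (G.totalDegree + 1)) ∧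
      eval (fun j => (v j : ℂ)) G ≠ 0 := by
    intro N
    by_contra! hcon
    refine hG (eq_zero_of_eval_zero_at_prod_finset G (fun j =>
      (Finset.Ioc ⌊N * c j⌋₊ (⌊N * c j⌋₊ + (G.totalDegree + 1))).image ((↑) : ℕ → ℂ))
      (fun j => ?_) fun x hx => ?_)
    · rw [Finset.card_image_of_injective _ Nat.cast_injective, Nat.card_Ioc]
      have := degreeOf_le_totalDegree G j
      omega
    · simp only [Finset.mem_image, Finset.mem_Ioc] at hx
      choose v hv hvx using hx
      have hxv : x = fun j => (v j : ℂ) := funext fun j => (hvx j).symm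
      rw [hxv]
      exact hcon v hv
  choose u hu huG using hex
  refine ⟨u, fun N j => (Nat.zero_le _).trans_lt (hu N j).1, huG, ?_⟩
  rw [tendsto_pi_nhds]
  intro j
  have hlim : Filter.Tendsto (fun N : ℕ => c j + ((G.totalDegree : ℝ) + 1) / N) Filter.atTop
      (nhds (c j)) := by
    simpa using (tendsto_const_div_atTop_nhds_zero_nat ((G.totalDegree : ℝ) + 1)).const_add (c j)
  refine tendsto_of_tendsto_of_tendsto_of_le_of_le' tendsto_const_nhds hlim ?_ ?_
  · filter_upwards [Filter.eventually_gt_atTop 0] with N hN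
    have hN' : (0 : ℝ) < N := by exact_mod_cast hN
    rw [le_div_iff₀ hN', mul_comm]
    have h1 := Nat.lt_floor_add_one (N * c j)
    have h2 : ((⌊N * c j⌋₊ : ℝ) + 1) ≤ u N j := by exact_mod_cast (hu N j).1
    linarith
  · filter_upwards [Filter.eventually_gt_atTop 0] with N hN
    have hN' : (0 : ℝ) < N := by exact_mod_cast hN
    rw [div_le_iff₀ hN', add_mul, div_mul_cancel₀ _ hN'.ne']
    have h1 := Nat.floor_le (mul_nonneg hN'.le (hc j))
    have h2 : (u N j : ℝ) ≤ ⌊N * c j⌋₊ + (G.totalDegree + 1) := by exact_mod_cast (hu N j).2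
    linarith

/-- The real points over which the likelihood function of generic positive integer data has its
critical points. -/
def dataPoints (m : Fin s → Fin d → ℤ) (G : MvPolynomial (Fin s) ℂ) : Set (Fin d → ℝ) :=
  {p | ∃ u : Fin s → ℕ, (∀ j, 0 < u j) ∧ eval (fun j => (u j : ℂ)) G ≠ 0 ∧
    p = (∑ j, (u j : ℝ))⁻¹ • realMoment m (fun j => (u j : ℝ))}

theorem subset_closure_dataPoints {P : Set (Fin d → ℝ)}
    (hP : P = realMoment m '' stdSimplex ℝ (Fin s)) (G : MvPolynomial (Fin s) ℂ) (hG : G ≠ 0) :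
    P ⊆ closure (dataPoints m G) := by
  intro p hp
  rw [hP] at hp
  obtain ⟨c, hc, rfl⟩ := hp
  obtain ⟨u, hu, huG, hlim⟩ := exists_nat_approximation G hG c hc.1
  have hcont : ContinuousAt (fun x : Fin s → ℝ => (∑ j, x j)⁻¹ • realMoment m x) c := by
    have h1 : ContinuousAt (fun x : Fin s → ℝ => ∑ j, x j) c := by fun_prop
    exact (h1.inv₀ (by rw [hc.2]; exact one_ne_zero)).smul (continuous_realMoment m).continuousAt
  have h2 := hcont.tendsto.comp hlim
  simp only [hc.2, inv_one, one_smul] at h2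
  refine mem_closure_of_tendsto h2 ?_
  filter_upwards [Filter.eventually_gt_atTop 0] with N hN
  have hN' : (N : ℝ) ≠ 0 := by exact_mod_cast hN.ne'
  refine ⟨u N, hu N, huG N, ?_⟩
  have h3 : (fun j => (u N j : ℝ) / N) = (N : ℝ)⁻¹ • fun j => (u N j : ℝ) := by
    funext j
    simp [div_eq_inv_mul]
  simp only [Function.comp_apply, ← Finset.sum_div]
  rw [h3, map_smul, smul_smul]
  congr 1
  field_simp

theorem subset_closure_interior {P : Set (Fin d → ℝ)} (hconv : Convex ℝ P)
    (hfull : (interior P).Nonempty) : P ⊆ closure (interior P) := by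
  rw [hconv.closure_interior_eq_closure_of_nonempty_interior hfull]
  exact subset_closure

theorem subset_closure_interior_inter {P D : Set (Fin d → ℝ)} (hconv : Convex ℝ P)
    (hfull : (interior P).Nonempty) (hD : P ⊆ closure D) : P ⊆ closure (interior P ∩ D) := by
  refine (subset_closure_interior hconv hfull).trans (closure_minimal ?_ isClosed_closure)
  exact fun p hp => isOpen_interior.inter_closure ⟨hp, hD (interior_subset hp)⟩

/-- An open real set contains a box, a product of infinite sets, on which no nonzero complex
polynomial vanishes identically. -/
theorem exists_mem_eval_realToComplex_ne_zero {q : MvPolynomial (Fin d) ℂ} (hq : q ≠ 0)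
    {U : Set (Fin d → ℝ)} (hU : IsOpen U) (hne : U.Nonempty) :
    ∃ p ∈ U, eval (realToComplex p) q ≠ 0 := by
  obtain ⟨p₀, hp₀⟩ := hne
  obtain ⟨r, hr, hball⟩ := Metric.isOpen_iff.1 hU p₀ hp₀
  by_contra! hcon
  refine hq (funext_set (fun i => ((↑) : ℝ → ℂ) '' Set.Ioo (p₀ i - r) (p₀ i + r))
    (fun i => (Set.Ioo_infinite (by linarith)).image Complex.ofReal_injective.injOn) ?_)
  intro x hx
  simp only [Set.mem_univ_pi, Set.mem_image] at hx
  choose p hp hpx using hx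
  have hxp : x = realToComplex p := funext fun i => (hpx i).symm
  rw [hxp, map_zero]
  refine hcon p (hball ?_)
  rw [Metric.mem_ball, dist_pi_lt_iff hr]
  intro i
  rw [Real.dist_eq, abs_lt]
  have := hp i
  constructor <;> linarith [this.1, this.2]

theorem subset_closure_eval_ne_zero {P : Set (Fin d → ℝ)} (hconv : Convex ℝ P)
    (hfull : (interior P).Nonempty) {q : MvPolynomial (Fin d) ℂ} (hq : q ≠ 0) :
    P ⊆ closure {p | p ∈ P ∧ eval (realToComplex p) q ≠ 0} := by
  refine (subset_closure_interior hconv hfull).trans (closure_minimal ?_ isClosed_closure)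
  intro p hp
  rw [mem_closure_iff]
  intro o ho hpo
  obtain ⟨p', hp', hne⟩ := exists_mem_eval_realToComplex_ne_zero hq (ho.inter isOpen_interior)
    ⟨p, hpo, hp⟩
  exact ⟨p', hp'.1, interior_subset hp'.2, hne⟩

theorem continuous_eval_realToComplex (q : MvPolynomial (Fin d) ℂ) :
    Continuous fun p : Fin d → ℝ => eval (realToComplex p) q := by
  refine (MvPolynomial.continuous_eval q).comp (continuous_pi fun i => ?_)
  exact Complex.continuous_ofReal.comp (continuous_apply i)

/-- A continuous function on a full-dimensional convex set vanishes if its product with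
a nonzero polynomial vanishes. -/
theorem eq_zero_of_eval_mul_eq_zero {P : Set (Fin d → ℝ)} (hconv : Convex ℝ P)
    (hfull : (interior P).Nonempty) {q : MvPolynomial (Fin d) ℂ} (hq : q ≠ 0)
    {ψ : (Fin d → ℝ) → ℂ} (hψ : ContinuousOn ψ P)
    (h : ∀ p ∈ P, eval (realToComplex p) q * ψ p = 0) : ∀ p ∈ P, ψ p = 0 := by
  have : Set.EqOn ψ 0 P := Set.EqOn.of_subset_closure
    (s := {p | p ∈ P ∧ eval (realToComplex p) q ≠ 0})
    (fun p hp => (mul_eq_zero.1 (h p hp.1)).resolve_left hp.2) hψ continuousOn_const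
    (fun p hp => hp.1) (subset_closure_eval_ne_zero hconv hfull hq)
  exact this

end Density

/-! ### Values of rational functions -/

section RationalFunctions

variable {d s : ℕ}

theorem exists_common_denominator {ι : Type*} [Finite ι] (b : ι → RatFun d) :
    ∃ (f : ι → MvPolynomial (Fin d) ℂ) (g : MvPolynomial (Fin d) ℂ), g ≠ 0 ∧
      ∀ j, b j = algebraMap _ (RatFun d) (f j) / algebraMap _ (RatFun d) g := by
  obtain ⟨⟨g, hg⟩, h⟩ := IsLocalization.exist_integer_multiples_of_finite
    (nonZeroDivisors (MvPolynomial (Fin d) ℂ)) b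
  choose f hf using h
  have hg0 := nonZeroDivisors.ne_zero hg
  refine ⟨f, g, hg0, fun j => ?_⟩
  have hg1 : algebraMap _ (RatFun d) g ≠ 0 := by simpa using hg0
  rw [eq_div_iff hg1, hf j]
  exact (mul_comm _ _).trans (Algebra.smul_def g (b j)).symm

theorem algebraMap_ne_zero_of_eval_ne_zero {p : Fin d → ℂ} {g : MvPolynomial (Fin d) ℂ}
    (hg : eval p g ≠ 0) : algebraMap _ (RatFun d) g ≠ 0 := by
  have : g ≠ 0 := fun h => hg (by rw [h, map_zero])
  simpa using this

/-- The value may come from a different fraction than `f / g`; cross-multiplication gives a relation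
that remains valid where `g` vanishes at `p`. -/
theorem HasValueAt.eval_eq_mul {r : RatFun d} {p : Fin d → ℂ} {c : ℂ} (h : HasValueAt r p c)
    {f g : MvPolynomial (Fin d) ℂ} (hg : g ≠ 0)
    (hr : r = algebraMap _ (RatFun d) f / algebraMap _ (RatFun d) g) :
    eval p f = c * eval p g := by
  obtain ⟨f', g', hg', hr', rfl⟩ := h
  have hg1 : algebraMap _ (RatFun d) g ≠ 0 := by simpa using hg
  have h1 : algebraMap _ (RatFun d) (f * g') = algebraMap _ (RatFun d) (f' * g) := by
    rw [map_mul, map_mul, ← div_eq_div_iff hg1 (algebraMap_ne_zero_of_eval_ne_zero hg'), ← hr, hr']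
  have h2 := congrArg (eval p) (IsFractionRing.injective _ (RatFun d) h1)
  rw [map_mul, map_mul] at h2
  field_simp
  exact h2

theorem HasValueAt.eq_zero {p : Fin d → ℂ} {c : ℂ} (h : HasValueAt (0 : RatFun d) p c) :
    c = 0 := by
  have := h.eval_eq_mul (f := 0) (g := 1) one_ne_zero (by simp)
  simpa using this.symm

theorem hasValueAt_algebraMap (f : MvPolynomial (Fin d) ℂ) (p : Fin d → ℂ) :
    HasValueAt (algebraMap _ (RatFun d) f) p (eval p f) :=
  ⟨f, 1, by simp, by simp, by simp⟩

theorem HasValueAt.add {r r' : RatFun d} {p : Fin d → ℂ} {c c' : ℂ} (h : HasValueAt r p c)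
    (h' : HasValueAt r' p c') : HasValueAt (r + r') p (c + c') := by
  obtain ⟨f, g, hg, rfl, rfl⟩ := h
  obtain ⟨f', g', hg', rfl, rfl⟩ := h'
  refine ⟨f * g' + g * f', g * g', by simp [hg, hg'], ?_, ?_⟩
  · rw [div_add_div _ _ (algebraMap_ne_zero_of_eval_ne_zero hg)
      (algebraMap_ne_zero_of_eval_ne_zero hg')]
    simp only [map_add, map_mul]
  · rw [div_add_div _ _ hg hg']
    simp only [map_add, map_mul]

theorem HasValueAt.mul {r r' : RatFun d} {p : Fin d → ℂ} {c c' : ℂ} (h : HasValueAt r p c)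
    (h' : HasValueAt r' p c') : HasValueAt (r * r') p (c * c') := by
  obtain ⟨f, g, hg, rfl, rfl⟩ := h
  obtain ⟨f', g', hg', rfl, rfl⟩ := h'
  refine ⟨f * f', g * g', by simp [hg, hg'], ?_, ?_⟩
  · rw [div_mul_div_comm]
    simp only [map_mul]
  · rw [div_mul_div_comm]
    simp only [map_mul]

theorem HasValueAt.aeval {b : Fin s → RatFun d} {p : Fin d → ℂ} {c : Fin s → ℂ}
    (h : ∀ j, HasValueAt (b j) p (c j)) (F : MvPolynomial (Fin s) ℂ) :
    HasValueAt (aeval b F) p (eval c F) := by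
  induction F using MvPolynomial.induction_on with
  | C a =>
    have := hasValueAt_algebraMap (C a) p
    rw [eval_C] at this
    rw [eval_C, aeval_C]
    rw [IsScalarTower.algebraMap_apply ℂ (MvPolynomial (Fin d) ℂ) (RatFun d)]
    exact this
  | add F F' hF hF' =>
    rw [map_add, map_add]
    exact hF.add hF'
  | mul_X F j hF =>
    rw [map_mul, map_mul, aeval_X, eval_X]
    exact hF.mul (h j)

end RationalFunctions

/-! ### Density of a parametrization, expressed by vanishing forms -/

section Closure

variable {d s : ℕ} {m : Fin s → Fin d → ℤ} {w : Fin s → ℝ}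

theorem projZariskiClosure_eq_iff (S T : Set (ℙ ℂ (Fin s → ℂ))) :
    projZariskiClosure S = projZariskiClosure T ↔ ∀ (n : ℕ) (F : MvPolynomial (Fin s) ℂ),
      F.IsHomogeneous n → ((∀ y ∈ S, eval y.rep F = 0) ↔ ∀ y ∈ T, eval y.rep F = 0) := by
  constructor
  · intro h n F hF
    have hsub : ∀ U : Set (ℙ ℂ (Fin s → ℂ)), U ⊆ projZariskiClosure U :=
      fun U y hy n F _ h => h y hy
    have hS : S ⊆ projZariskiClosure T := h ▸ hsub S
    have hT : T ⊆ projZariskiClosure S := h ▸ hsub T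
    exact ⟨fun h1 y hy => hT hy n F hF h1, fun h1 y hy => hS hy n F hF h1⟩
  · intro h
    ext x
    exact forall_congr' fun n => forall_congr' fun F => forall_congr' fun hF =>
      imp_congr_left (h n F hF)

theorem projZariskiClosure_ratMapImage_eq_iff (hw : ∀ j, 0 < w j) (hs : 0 < s)
    (b : Fin s → RatFun d) :
    projZariskiClosure (ratMapImage b) = scaledProjToric m w ↔
      ∀ (n : ℕ) (F : MvPolynomial (Fin s) ℂ), F.IsHomogeneous n →
        ((∀ p c, c ≠ 0 → (∀ j, HasValueAt (b j) p (c j)) → eval c F = 0) ↔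
          ∀ t, eval (scaledMonomials m w t) F = 0) := by
  rw [scaledProjToric, projZariskiClosure_eq_iff]
  refine forall_congr' fun n => forall_congr' fun F => forall_congr' fun hF => iff_congr ?_ ?_
  · constructor
    · intro h p c hc hv
      rw [← eval_rep_mk_eq_zero_iff hF c hc]
      exact h _ ⟨p, c, hc, hv, rfl⟩
    · rintro h _ ⟨p, c, hc, hv, rfl⟩
      rw [eval_rep_mk_eq_zero_iff hF c hc]
      exact h p c hc hv
  · constructor
    · intro h t
      rw [← eval_rep_mk_eq_zero_iff hF _ (scaledMonomials_ne_zero hw hs t)]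
      exact h _ ⟨t, _, rfl⟩
    · rintro h _ ⟨t, ht, rfl⟩
      rw [eval_rep_mk_eq_zero_iff hF _ ht]
      exact h t

end Closure

/-! ### Linear precision implies ML degree one -/

section Forward

variable {d s : ℕ} {m : Fin s → Fin d → ℤ} {w : Fin s → ℝ}

/-- The coordinates of the moment map as linear polynomials. -/
noncomputable def momentPolynomial (m : Fin s → Fin d → ℤ) (i : Fin d) : MvPolynomial (Fin s) ℂ :=
  ∑ j, X j * C (m j i : ℂ)

theorem eval_momentPolynomial (y : Fin s → ℂ) (i : Fin d) :
    eval y (momentPolynomial m i) = moment m y i := by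
  simp [momentPolynomial, moment]

theorem eval_aeval_momentPolynomial (y : Fin s → ℂ) (q : MvPolynomial (Fin d) ℂ) :
    eval y (aeval (momentPolynomial m) q) = eval (moment m y) q := by
  rw [eval_aeval]
  simp only [eval_momentPolynomial]

theorem moment_ofReal (x : Fin s → ℝ) :
    moment m (fun j => (x j : ℂ)) = realToComplex (realMoment m x) := by
  funext i
  simp [moment, realToComplex, realMoment_apply_apply]

theorem sum_natCast_ne_zero (hs : 0 < s) {u : Fin s → ℕ} (hu : ∀ j, 0 < u j) :
    (∑ j, (u j : ℂ)) ≠ 0 := by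
  have : 0 < ∑ j, u j := Finset.sum_pos (fun j _ => hu j) ⟨⟨0, hs⟩, Finset.mem_univ _⟩
  exact_mod_cast this.ne'

/-- Linear precision, as polynomial identities between numerators and denominator. -/
theorem numerators_linear_precision {P : Set (Fin d → ℝ)} (hconv : Convex ℝ P)
    (hfull : (interior P).Nonempty) {b : Fin s → RatFun d} {φ : Fin s → (Fin d → ℝ) → ℝ}
    (hφ : ∀ j, IsContinuousExtensionOn P (b j) (φ j))
    (hφm : ∀ p ∈ P, ∑ j, φ j p • latticeToReal (m j) = p)
    {f : Fin s → MvPolynomial (Fin d) ℂ} {g : MvPolynomial (Fin d) ℂ} (hg : g ≠ 0)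
    (hb : ∀ j, b j = algebraMap _ (RatFun d) (f j) / algebraMap _ (RatFun d) g) (i : Fin d) :
    ∑ j, f j * C (m j i : ℂ) = g * X i := by
  rw [← sub_eq_zero]
  by_contra hne
  obtain ⟨p, hp, hpne⟩ := exists_mem_eval_realToComplex_ne_zero hne isOpen_interior hfull
  refine hpne (eq_zero_of_eval_mul_eq_zero hconv hfull hg
    (continuous_eval_realToComplex _).continuousOn (fun q hq => ?_) p (interior_subset hp))
  by_cases hgq : eval (realToComplex q) g = 0
  · rw [hgq, zero_mul]
  · have h1 : ∀ j, eval (realToComplex q) (f j) = eval (realToComplex q) g * (φ j q : ℂ) := by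
      intro j
      have := (hφ j).2 q hq _ ⟨f j, g, hgq, hb j, rfl⟩
      rw [← this]
      field_simp
    have h2 : ∑ j, (φ j q : ℂ) * (m j i : ℂ) = (q i : ℂ) := by
      have := congrFun (hφm q hq) i
      simp only [Finset.sum_apply, Pi.smul_apply, smul_eq_mul, latticeToReal] at this
      exact_mod_cast congrArg ((↑) : ℝ → ℂ) this
    have h3 : eval (realToComplex q) (∑ j, f j * C (m j i : ℂ) - g * X i) = 0 := by
      simp only [map_sub, map_sum, map_mul, eval_C, eval_X, h1, mul_assoc, ← Finset.mul_sum, h2]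
      simp [realToComplex]
    rw [h3, mul_zero]

theorem hasMLDegree_one_of_hasRationalLinearPrecision {P : Set (Fin d → ℝ)}
    (hP : P = realMoment m '' stdSimplex ℝ (Fin s)) (hfull : (interior P).Nonempty)
    (hw : ∀ j, 0 < w j) (hs : 0 < s) (h : HasRationalLinearPrecision P m w) :
    HasMLDegree (scaledVeryAffineToric m w) 1 := by
  have hconv : Convex ℝ P := by
    rw [hP]
    exact (convex_stdSimplex ℝ (Fin s)).linear_image _
  obtain ⟨b, hsum, hcl, φ, hφ, -, hφm⟩ := h
  rw [projZariskiClosure_ratMapImage_eq_iff hw hs] at hcl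
  obtain ⟨f, g, hg, hb⟩ := exists_common_denominator b
  have hgL : algebraMap _ (RatFun d) g ≠ 0 := by simpa using hg
  have hfm := numerators_linear_precision hconv hfull hφ hφm hg hb
  have hfg : ∑ j, f j = g := by
    apply IsFractionRing.injective _ (RatFun d)
    simp only [hb, ← Finset.sum_div] at hsum
    rw [map_sum]
    exact (div_eq_one_iff_eq hgL).1 hsum
  have hbm : ∀ i, aeval b (momentPolynomial m i) =
      algebraMap (MvPolynomial (Fin d) ℂ) (RatFun d) (X i) := by
    intro i
    have h1 := congrArg (algebraMap _ (RatFun d)) (hfm i)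
    rw [map_mul, map_sum] at h1
    have h2 : aeval b (momentPolynomial m i) =
        (∑ j, algebraMap _ (RatFun d) (f j * C (m j i : ℂ))) / algebraMap _ (RatFun d) g := by
      simp only [momentPolynomial, map_sum, map_mul, aeval_X, aeval_C, Finset.sum_div]
      refine Finset.sum_congr rfl fun j _ => ?_
      rw [hb j, div_mul_eq_mul_div,
        IsScalarTower.algebraMap_apply ℂ (MvPolynomial (Fin d) ℂ) (RatFun d)]
      rfl
    rw [h2, h1, mul_div_cancel_left₀ _ hgL]
  have hval : ∀ p c, (∀ j, HasValueAt (b j) p (c j)) → ∑ j, c j = 1 ∧ moment m c = p := by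
    intro p c hc
    constructor
    · have := HasValueAt.aeval hc (∑ j, X j - 1)
      simp only [map_sub, map_sum, aeval_X, map_one, hsum, sub_self, eval_X] at this
      exact sub_eq_zero.1 this.eq_zero
    · funext i
      have := HasValueAt.aeval hc (momentPolynomial m i)
      rw [hbm, eval_momentPolynomial] at this
      have h2 := this.eval_eq_mul (f := X i) (g := 1) one_ne_zero (by simp)
      simpa using h2.symm
  -- If `f j = 0`, the form `X j` vanishes on the image of `b`, hence on the torus orbit, where no
  -- coordinate is zero.
  have hf0 : ∀ j, f j ≠ 0 := by
    intro j hj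
    have h1 := (hcl 1 (X j) (isHomogeneous_X _ j)).1 fun p c _ hc => by
      have := hc j
      rw [hb j, hj, map_zero, zero_div] at this
      rw [eval_X, this.eq_zero]
    have := h1 1
    rw [eval_X] at this
    exact scaledMonomials_apply_ne_zero hw 1 j this
  -- The equation `f_j(moment x) = x_j g(moment x)` holds on the image of `b`, since `b` is a
  -- section. Homogenized, it passes to the toric cone: a point of `Y` is determined by its moment
  -- when `g` does not vanish there.
  have hunique : ∀ y ∈ scaledVeryAffineToric m w, ∀ j,
      eval (moment m y) (f j) = y j * eval (moment m y) g := by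
    intro y hy j
    obtain ⟨-, hysum, hyc⟩ := (mem_scaledVeryAffineToric_iff hw).1 hy
    let F : MvPolynomial (Fin s) ℂ :=
      aeval (momentPolynomial m) (f j) - X j * aeval (momentPolynomial m) g
    have hF : ∀ x, eval x F = eval (moment m x) (f j) - x j * eval (moment m x) g := fun x => by
      simp only [F, map_sub, map_mul, eval_X, eval_aeval_momentPolynomial]
    have h1 : ∀ x : Fin s → ℂ, ∑ j, x j = 1 → eval x (homogenizeBySum F) = eval x F := by
      intro x hx
      rw [eval_homogenizeBySum F x (by rw [hx]; exact one_ne_zero), hx]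
      simp
    have h2 := hyc _ _ (isHomogeneous_homogenizeBySum F)
      ((hcl _ _ (isHomogeneous_homogenizeBySum F)).1 fun p c _ hc => by
        obtain ⟨hcs, hcm⟩ := hval p c hc
        rw [h1 c hcs, hF, hcm, (hc j).eval_eq_mul hg (hb j), sub_self])
    rw [h1 y hysum, hF] at h2
    exact sub_eq_zero.1 h2
  -- Genericity avoids the zeros of `g`, where the fraction is undefined, and those of the `f j`,
  -- where the section leaves the torus `(ℂ^*)^s`.
  let q : MvPolynomial (Fin d) ℂ := g * ∏ j, f j
  have hq : q ≠ 0 := mul_ne_zero hg (Finset.prod_ne_zero_iff.2 fun j _ => hf0 j)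
  refine ⟨homogenizeBySum (aeval (momentPolynomial m) q), ?_, ?_⟩
  · intro h0
    obtain ⟨p, hp, hpne⟩ := exists_mem_eval_realToComplex_ne_zero hq isOpen_interior hfull
    have hp' := interior_subset hp
    rw [hP] at hp'
    obtain ⟨c, hc, rfl⟩ := hp'
    have hc1 : ∑ j, (c j : ℂ) = 1 := by exact_mod_cast congrArg ((↑) : ℝ → ℂ) hc.2
    have h1 := eval_homogenizeBySum (aeval (momentPolynomial m) q) (fun j => (c j : ℂ))
      (by rw [hc1]; exact one_ne_zero)
    rw [h0, map_zero, hc1, one_pow, inv_one, one_smul, one_mul, eval_aeval_momentPolynomial,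
      moment_ofReal] at h1
    exact hpne h1.symm
  · intro u hu huG
    have hu0 := sum_natCast_ne_zero hs hu
    rw [eval_homogenizeBySum _ _ hu0, eval_aeval_momentPolynomial] at huG
    set p := moment m ((∑ j, (u j : ℂ))⁻¹ • fun j => (u j : ℂ)) with hp
    have hqp : eval p q ≠ 0 := right_ne_zero_of_mul huG
    simp only [q, map_mul, map_prod] at hqp
    have hgp : eval p g ≠ 0 := left_ne_zero_of_mul hqp
    have hfp : ∀ j, eval p (f j) ≠ 0 := fun j =>
      Finset.prod_ne_zero_iff.1 (right_ne_zero_of_mul hqp) j (Finset.mem_univ j)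
    have hcrit : ∀ y, (∑ j, (u j : ℂ)) • moment m y = moment m (fun j => (u j : ℂ)) ↔
        moment m y = p := by
      intro y
      rw [hp, moment_smul, eq_inv_smul_iff₀ hu0]
    have hset : likelihoodCriticalPoints (scaledVeryAffineToric m w) u =
        {fun j => eval p (f j) / eval p g} := by
      ext y
      rw [mem_likelihoodCriticalPoints_iff hw, hcrit, Set.mem_singleton_iff]
      constructor
      · rintro ⟨hy, hyp⟩
        funext j
        have := hunique y hy j
        rw [hyp] at this
        rw [this]
        field_simp
      · rintro rfl
        have hc : ∀ j, HasValueAt (b j) p (eval p (f j) / eval p g) :=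
          fun j => ⟨f j, g, hgp, hb j, rfl⟩
        obtain ⟨hcs, hcm⟩ := hval p _ hc
        refine ⟨(mem_scaledVeryAffineToric_iff hw).2
          ⟨fun j => div_ne_zero (hfp j) hgp, hcs, fun n F hF hF0 => ?_⟩, hcm⟩
        exact (hcl n F hF).2 hF0 p _
          (fun h0 => div_ne_zero (hfp ⟨0, hs⟩) hgp (congrFun h0 _)) hc
    rw [hset, Set.encard_singleton]
    rfl

end Forward

/-! ### Zariski density of the positive points -/

section PositivePoints

variable {d s : ℕ} {m : Fin s → Fin d → ℤ} {w : Fin s → ℝ}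

/-- The point of the complex torus with the given real logarithmic coordinates. -/
noncomputable def expUnits (θ : Fin d → ℝ) : Fin d → ℂˣ :=
  fun i => Units.mk0 (Real.exp (θ i) : ℂ) (by exact_mod_cast (Real.exp_pos _).ne')

theorem ofReal_gibbsPoint (θ : Fin d → ℝ) :
    (fun j => (gibbsPoint m w θ j : ℂ)) =
      (((∑ k, w k * Real.exp (∑ i, (m k i : ℝ) * θ i) : ℝ) : ℂ))⁻¹ •
        scaledMonomials m w (expUnits θ) := by
  funext j
  have h : ((∏ i, expUnits θ i ^ m j i : ℂˣ) : ℂ) =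
      ((Real.exp (∑ i, (m j i : ℝ) * θ i) : ℝ) : ℂ) := by
    rw [Real.exp_sum, Units.coe_prod, Complex.ofReal_prod]
    refine Finset.prod_congr rfl fun i _ => ?_
    rw [Units.val_zpow_eq_zpow_val, expUnits, Units.val_mk0, ← Complex.ofReal_zpow,
      mul_comm, Real.exp_mul, Real.rpow_intCast]
  rw [Pi.smul_apply, smul_eq_mul, scaledMonomials, h, gibbsPoint, Complex.ofReal_div,
    Complex.ofReal_mul, div_eq_inv_mul]

theorem inToricCone_gibbsPoint (θ : Fin d → ℝ) :
    InToricCone m w (fun j => (gibbsPoint m w θ j : ℂ)) := by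
  rw [ofReal_gibbsPoint]
  exact (inToricCone_scaledMonomials _).smul _

/-- The positive real points are Zariski dense in the toric variety. -/
theorem eval_scaledMonomials_eq_zero_of_gibbsPoint (hw : ∀ j, 0 < w j) (hs : 0 < s) {n : ℕ}
    {F : MvPolynomial (Fin s) ℂ} (hF : F.IsHomogeneous n)
    (h : ∀ θ, eval (fun j => (gibbsPoint m w θ j : ℂ)) F = 0) (t : Fin d → ℂˣ) :
    eval (scaledMonomials m w t) F = 0 := by
  have h1 : ∀ θ, eval (scaledMonomials m w (expUnits θ)) F = 0 := by
    intro θ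
    have h2 := h θ
    rw [ofReal_gibbsPoint, eval_smul_of_isHomogeneous hF] at h2
    refine (mul_eq_zero.1 h2).resolve_left (pow_ne_zero _ (inv_ne_zero ?_))
    exact_mod_cast (gibbs_denominator_pos hw hs θ).ne'
  -- Shifting all exponents by `N` turns Laurent monomials into polynomials; as `F` is homogeneous,
  -- this only multiplies its value by a nonzero factor.
  let N : ℕ := ∑ j, ∑ i, (m j i).natAbs
  have hN : ∀ j i, 0 ≤ m j i + N := by
    intro j i
    have h2 : (m j i).natAbs ≤ N :=
      (Finset.single_le_sum (f := fun i => (m j i).natAbs) (fun _ _ => Nat.zero_le _)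
        (Finset.mem_univ i)).trans
      (Finset.single_le_sum (f := fun j => ∑ i, (m j i).natAbs) (fun _ _ => Nat.zero_le _)
        (Finset.mem_univ j))
    omega
  let Q : MvPolynomial (Fin d) ℂ :=
    aeval (fun j => C (w j : ℂ) * ∏ i, X i ^ (m j i + N).toNat) F
  have hQ : ∀ t : Fin d → ℂˣ, eval (fun i => (t i : ℂ)) Q =
      (∏ i, (t i : ℂ) ^ N) ^ n * eval (scaledMonomials m w t) F := by
    intro t
    rw [← eval_smul_of_isHomogeneous hF, eval_aeval]
    congr 2
    funext j
    simp only [map_mul, eval_C, map_prod, map_pow, eval_X, Pi.smul_apply, smul_eq_mul,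
      scaledMonomials]
    rw [Units.coe_prod, mul_left_comm, ← Finset.prod_mul_distrib]
    congr 1
    refine Finset.prod_congr rfl fun i _ => ?_
    rw [Units.val_zpow_eq_zpow_val, ← zpow_natCast, ← zpow_natCast,
      ← zpow_add₀ (Units.ne_zero (t i)), Int.toNat_of_nonneg (hN j i), add_comm]
  have hQ0 : Q = 0 := by
    refine funext_set (fun _ => ((↑) : ℝ → ℂ) '' Set.Ioi 0)
      (fun _ => (Set.Ioi_infinite 0).image Complex.ofReal_injective.injOn) fun x hx => ?_
    simp only [Set.mem_univ_pi, Set.mem_image, Set.mem_Ioi] at hx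
    choose r hr hrx using hx
    have hx' : x = fun i => (expUnits (fun i => Real.log (r i)) i : ℂ) := by
      funext i
      simp only [expUnits, Units.val_mk0, Real.exp_log (hr i)]
      exact (hrx i).symm
    rw [hx', hQ, h1, mul_zero, map_zero]
  have h3 := hQ t
  rw [hQ0, map_zero] at h3
  exact (mul_eq_zero.1 h3.symm).resolve_left (pow_ne_zero _
    (Finset.prod_ne_zero_iff.2 fun i _ => pow_ne_zero _ (Units.ne_zero _)))

end PositivePoints

/-! ### The fibre of the moment map as a polynomial system -/

section FibreEquations

variable {d s : ℕ} {m : Fin s → Fin d → ℤ} {w : Fin s → ℝ}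

/-- The equations, over the coordinate ring of affine space, of the fibre of the moment map on
the very affine toric variety; the additional variable is the inverse of the product of the
coordinates. -/
def fibreEquations (m : Fin s → Fin d → ℤ) (w : Fin s → ℝ) :
    Set (MvPolynomial (Option (Fin s)) (MvPolynomial (Fin d) ℂ)) :=
  {X none * ∏ j, X (some j) - 1} ∪ {∑ j, X (some j) - 1} ∪
    Set.range (fun i => ∑ j, C (C (m j i : ℂ)) * X (some j) - C (X i)) ∪
    {E | ∃ (n : ℕ) (F : MvPolynomial (Fin s) ℂ), F.IsHomogeneous n ∧
      (∀ t, eval (scaledMonomials m w t) F = 0) ∧ E = rename some (map C F)}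

/-- The target `K` is kept general because the system is read both at points, over `ℂ`, and over the
field of rational functions. -/
theorem forall_fibreEquations_iff {K : Type*} [CommRing K] (ε : MvPolynomial (Fin d) ℂ →+* K)
    (y : Option (Fin s) → K) :
    (∀ E ∈ fibreEquations m w, eval₂ ε y E = 0) ↔
      y none * ∏ j, y (some j) = 1 ∧ ∑ j, y (some j) = 1 ∧
      (∀ i, ∑ j, ε (C (m j i : ℂ)) * y (some j) = ε (X i)) ∧
      ∀ (n : ℕ) (F : MvPolynomial (Fin s) ℂ), F.IsHomogeneous n →
        (∀ t, eval (scaledMonomials m w t) F = 0) →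
        eval₂ (ε.comp C) (fun j => y (some j)) F = 0 := by
  have h1 : eval₂ ε y (X none * ∏ j, X (some j) - 1) = y none * ∏ j, y (some j) - 1 := by
    simp [eval₂_prod]
  have h2 : eval₂ ε y (∑ j, X (some j) - 1) = ∑ j, y (some j) - 1 := by
    simp [eval₂_sum]
  have h3 : ∀ i, eval₂ ε y (∑ j, C (C (m j i : ℂ)) * X (some j) - C (X i)) =
      ∑ j, ε (C (m j i : ℂ)) * y (some j) - ε (X i) := by
    intro i
    simp only [eval₂_sub, eval₂_sum, eval₂_mul, eval₂_C, eval₂_X]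
  have h4 : ∀ F : MvPolynomial (Fin s) ℂ, eval₂ ε y (rename some (map C F)) =
      eval₂ (ε.comp C) (fun j => y (some j)) F := by
    intro F
    rw [eval₂_rename, eval₂_map]
    rfl
  constructor
  · intro h
    refine ⟨sub_eq_zero.1 (h1 ▸ h _ (.inl (.inl (.inl rfl)))),
      sub_eq_zero.1 (h2 ▸ h _ (.inl (.inl (.inr rfl)))), fun i =>
      sub_eq_zero.1 (h3 i ▸ h _ (.inl (.inr ⟨i, rfl⟩))), fun n F hF hF0 => ?_⟩
    rw [← h4]
    exact h _ (.inr ⟨n, F, hF, hF0, rfl⟩)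
  · rintro ⟨e1, e2, e3, e4⟩ E (((rfl | rfl) | ⟨i, rfl⟩) | ⟨n, F, hF, hF0, rfl⟩)
    · rw [h1, e1, sub_self]
    · rw [h2, e2, sub_self]
    · rw [h3, e3, sub_self]
    · rw [h4, e4 n F hF hF0]

theorem forall_fibreEquations_eval_iff (hw : ∀ j, 0 < w j) (p : Fin d → ℂ)
    (y : Option (Fin s) → ℂ) :
    (∀ E ∈ fibreEquations m w, eval₂ (eval p) y E = 0) ↔
      (fun j => y (some j)) ∈ scaledVeryAffineToric m w ∧ moment m (fun j => y (some j)) = p ∧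
        y none = (∏ j, y (some j))⁻¹ := by
  have hid : (eval p).comp C = RingHom.id ℂ := by
    ext
    simp
  rw [forall_fibreEquations_iff, hid, mem_scaledVeryAffineToric_iff hw]
  simp only [eval_C, eval_X]
  constructor
  · rintro ⟨e1, e2, e3, e4⟩
    have hne : ∏ j, y (some j) ≠ 0 := right_ne_zero_of_mul (e1 ▸ one_ne_zero)
    refine ⟨⟨fun j => Finset.prod_ne_zero_iff.1 hne j (Finset.mem_univ j), e2, e4⟩, ?_,
      eq_inv_of_mul_eq_one_left e1⟩
    funext i
    rw [← e3 i, moment]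
    exact Finset.sum_congr rfl fun j _ => mul_comm _ _
  · rintro ⟨⟨e0, e2, e4⟩, rfl, e1⟩
    refine ⟨?_, e2, fun i => Finset.sum_congr rfl fun j _ => mul_comm _ _, e4⟩
    rw [e1, inv_mul_cancel₀ (Finset.prod_ne_zero_iff.2 fun j _ => e0 j)]

theorem HasValueAt.aeval_polynomial {σ : Type*} {b : σ → RatFun d} {p : Fin d → ℂ} {c : σ → ℂ}
    (h : ∀ j, HasValueAt (b j) p (c j)) (F : MvPolynomial σ (MvPolynomial (Fin d) ℂ)) :
    HasValueAt (MvPolynomial.aeval b F) p (eval₂ (eval p) c F) := by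
  induction F using MvPolynomial.induction_on with
  | C a =>
    rw [eval₂_C, aeval_C]
    exact hasValueAt_algebraMap a p
  | add F F' hF hF' =>
    rw [map_add, eval₂_add]
    exact hF.add hF'
  | mul_X F j hF =>
    rw [map_mul, eval₂_mul, aeval_X, eval₂_X]
    exact hF.mul (h j)

end FibreEquations

/-! ### ML degree one implies linear precision -/

section Backward

variable {d s : ℕ} {m : Fin s → Fin d → ℤ} {w : Fin s → ℝ}

theorem hasRationalLinearPrecision_of_hasMLDegree_one {P : Set (Fin d → ℝ)}
    (hlat : IsLatticePolytope P) (hfull : (interior P).Nonempty)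
    (hm : EnumeratesLatticePoints P m) (hw : ∀ j, 0 < w j) (hs : 0 < s)
    (h : HasMLDegree (scaledVeryAffineToric m w) 1) : HasRationalLinearPrecision P m w := by
  have hP := eq_realMoment_image_stdSimplex hlat hm
  have hconv : Convex ℝ P := by
    rw [hP]
    exact (convex_stdSimplex ℝ (Fin s)).linear_image _
  obtain ⟨G, hG, hML⟩ := h
  obtain ⟨φ, hφc, hφP, hφint, hφg⟩ := exists_continuous_moment_inverse hlat hfull hm hw hs
  let D : Set (Fin d → ℝ) := interior P ∩ dataPoints m G
  have hDP : D ⊆ P := fun p hp => interior_subset hp.1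
  have hPD : P ⊆ closure D :=
    subset_closure_interior_inter hconv hfull (subset_closure_dataPoints hP G hG)
  have hzero : ∀ a : MvPolynomial (Fin d) ℂ, (∀ p ∈ D, eval (realToComplex p) a = 0) → a = 0 := by
    intro a ha
    by_contra hne
    obtain ⟨p, hp, hpne⟩ := exists_mem_eval_realToComplex_ne_zero hne isOpen_interior hfull
    have : Set.EqOn (fun p => eval (realToComplex p) a) 0 P := Set.EqOn.of_subset_closure
      (s := D) ha (continuous_eval_realToComplex a).continuousOn continuousOn_const hDP hPD
    exact hpne (this (interior_subset hp))
  have hφY : ∀ p ∈ D, (fun j => (φ p j : ℂ)) ∈ scaledVeryAffineToric m w ∧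
      moment m (fun j => (φ p j : ℂ)) = realToComplex p := by
    intro p hp
    refine ⟨?_, by rw [moment_ofReal, (hφP p (hDP hp)).2]⟩
    obtain ⟨θ, hθ⟩ := hφint p hp.1
    rw [hθ, mem_scaledVeryAffineToric_iff hw]
    refine ⟨fun j => by exact_mod_cast (gibbsPoint_pos hw hs θ j).ne', ?_,
      inToricCone_gibbsPoint θ⟩
    exact_mod_cast congrArg ((↑) : ℝ → ℂ) (sum_gibbsPoint (m := m) hw hs θ)
  -- For `p` given by data `u`, every point of the fibre over `p` is critical for `ℓ_u`; there is
  -- only one, and the positive point `φ p` is one of them.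
  have huniq : ∀ p ∈ D, ∀ y ∈ scaledVeryAffineToric m w, moment m y = realToComplex p →
      y = fun j => (φ p j : ℂ) := by
    rintro p hp y hy hyp
    obtain ⟨u, hu, huG, hpu⟩ := hp.2
    have hu0 := sum_natCast_ne_zero hs hu
    have hu0' : (∑ j, (u j : ℝ)) ≠ 0 := by exact_mod_cast hu0
    have hmem : ∀ y ∈ scaledVeryAffineToric m w, moment m y = realToComplex p →
        y ∈ likelihoodCriticalPoints (scaledVeryAffineToric m w) u := by
      intro y hy hyp
      refine (mem_likelihoodCriticalPoints_iff hw u).2 ⟨hy, ?_⟩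
      have h1 : moment m (fun j => (u j : ℂ)) =
          realToComplex (realMoment m (fun j => (u j : ℝ))) := by
        rw [← moment_ofReal]
        simp
      have h2 : realMoment m (fun j => (u j : ℝ)) = (∑ j, (u j : ℝ)) • p := by
        rw [hpu, smul_inv_smul₀ hu0']
      rw [hyp, h1, h2]
      funext i
      simp [realToComplex]
    obtain ⟨y₀, hy₀⟩ := Set.encard_eq_one.1 ((hML u hu huG).trans Nat.cast_one)
    have e1 := hmem y hy hyp
    have e2 := hmem _ (hφY p hp).1 (hφY p hp).2
    rw [hy₀, Set.mem_singleton_iff] at e1 e2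
    rw [e1, e2]
  have huniq' : ∀ p ∈ D, ∀ y : Option (Fin s) → ℂ,
      (∀ E ∈ fibreEquations m w, eval₂ (eval (realToComplex p)) y E = 0) →
      y none = (∏ j, (φ p j : ℂ))⁻¹ ∧ (fun j => y (some j)) = fun j => (φ p j : ℂ) := by
    intro p hp y hy
    obtain ⟨hyY, hym, hy0⟩ := (forall_fibreEquations_eval_iff hw _ y).1 hy
    have h1 := huniq p hp _ hyY hym
    refine ⟨?_, h1⟩
    rw [hy0]
    exact congrArg (fun z : Fin s → ℂ => (∏ j, z j)⁻¹) h1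
  obtain ⟨b, hb⟩ := exists_solution_of_unique_specializations (fibreEquations m w)
    ((fun p => (eval (realToComplex p) : MvPolynomial (Fin d) ℂ →+* ℂ)) '' D)
    (fun a ha => hzero a fun p hp => ha _ ⟨p, hp, rfl⟩)
    (by
      rintro _ ⟨p, hp, rfl⟩
      refine ⟨fun o => o.elim (∏ j, (φ p j : ℂ))⁻¹ (fun j => (φ p j : ℂ)),
        (forall_fibreEquations_eval_iff hw _ _).2 ⟨(hφY p hp).1, (hφY p hp).2, rfl⟩⟩)
    (by
      rintro _ ⟨p, hp, rfl⟩ y y' hy hy'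
      obtain ⟨e1, e2⟩ := huniq' p hp y hy
      obtain ⟨e1', e2'⟩ := huniq' p hp y' hy'
      funext o
      cases o with
      | none => rw [e1, e1']
      | some j => exact congrFun (e2.trans e2'.symm) j)
  obtain ⟨f, g, hg, hfg⟩ := exists_common_denominator b
  have hbE : ∀ E ∈ fibreEquations m w, eval₂ (algebraMap _ (RatFun d)) b E = 0 := hb
  obtain ⟨-, hbsum, -, hbcone⟩ := (forall_fibreEquations_iff _ _).1 hbE
  have hφcj : ∀ j, ContinuousOn (fun p => (φ p j : ℂ)) P := fun j =>
    Complex.continuous_ofReal.comp_continuousOn ((continuous_apply j).comp_continuousOn hφc)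
  -- On `D` away from the zeros of `g`, the values of `b` solve the fibre equations and so equal
  -- `φ`. Multiplying by `g` absorbs the poles; continuity extends the identity to `P`, and density
  -- allows the factor `g` to be removed.
  have hfφ : ∀ j, ∀ p ∈ P, eval (realToComplex p) (f (some j)) =
      eval (realToComplex p) g * (φ p j : ℂ) := by
    intro j
    have hcont : ContinuousOn (fun p => eval (realToComplex p) (f (some j)) -
        eval (realToComplex p) g * (φ p j : ℂ)) P :=
      (continuous_eval_realToComplex _).continuousOn.sub
        ((continuous_eval_realToComplex _).continuousOn.mul (hφcj j))
    have h1 := eq_zero_of_eval_mul_eq_zero hconv hfull hg hcont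
      (Set.EqOn.of_subset_closure (s := D) (g := 0) (fun p hp => ?_)
        ((continuous_eval_realToComplex g).continuousOn.mul hcont) continuousOn_const hDP hPD)
    · exact fun p hp => sub_eq_zero.1 (h1 p hp)
    · by_cases hgp : eval (realToComplex p) g = 0
      · simp [hgp]
      · have hv : ∀ o, HasValueAt (b o) (realToComplex p)
            (eval (realToComplex p) (f o) / eval (realToComplex p) g) :=
          fun o => ⟨f o, g, hgp, hfg o, rfl⟩
        have h2 := (huniq' p hp _ fun E hE => by
          have := HasValueAt.aeval_polynomial hv E
          rw [hb E hE] at this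
          exact this.eq_zero).2
        have h3 := congrFun h2 j
        rw [← h3, mul_div_cancel₀ _ hgp]
        simp
  refine ⟨fun j => b (some j), hbsum, ?_, fun j p => φ p j, fun j => ⟨?_, ?_⟩, ?_, ?_⟩
  · rw [projZariskiClosure_ratMapImage_eq_iff hw hs]
    intro n F hF
    constructor
    · intro h0
      -- Positive points are values of `φ`, and those are values of `b` wherever `g ≠ 0`; by
      -- continuity a form vanishing on the image of `b` vanishes at all of them.
      refine eval_scaledMonomials_eq_zero_of_gibbsPoint hw hs hF fun θ => ?_
      have hcont : ContinuousOn (fun p => eval (fun j => (φ p j : ℂ)) F) P :=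
        (MvPolynomial.continuous_eval F).comp_continuousOn (continuousOn_pi.2 hφcj)
      have h1 := eq_zero_of_eval_mul_eq_zero hconv hfull hg hcont (fun p hp => ?_) _ (hφg θ).1
      · simpa only [(hφg θ).2] using h1
      · by_cases hgp : eval (realToComplex p) g = 0
        · rw [hgp, zero_mul]
        · rw [h0 (realToComplex p) _ ?_ fun j =>
            ⟨f (some j), g, hgp, hfg _, by rw [hfφ j p hp, mul_div_cancel_left₀ _ hgp]⟩, mul_zero]
          intro hz
          have h2 : ∑ j, (φ p j : ℂ) = 1 := by
            exact_mod_cast congrArg ((↑) : ℝ → ℂ) (hφP p hp).1.2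
          have h3 : ∀ j, (φ p j : ℂ) = 0 := fun j => congrFun hz j
          simp [h3] at h2
    · intro h0 p c _ hc
      have := HasValueAt.aeval hc F
      have h1 : MvPolynomial.aeval (fun j => b (some j)) F = 0 := by
        rw [← hbcone n F hF h0, aeval_def, IsScalarTower.algebraMap_eq ℂ (MvPolynomial (Fin d) ℂ)]
        rfl
      rw [h1] at this
      exact this.eq_zero
  · exact (continuous_apply j).comp_continuousOn hφc
  -- At a zero of `g` the value may come from another fraction `f' / g'`. It still equals `φ`,
  -- because `φ g' = f'` holds where `g ≠ 0` and extends by continuity.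
  · rintro p hp _ ⟨f', g', hg', hb', rfl⟩
    have hgL : algebraMap _ (RatFun d) g ≠ 0 := by simpa using hg
    have h1 : f (some j) * g' = f' * g := by
      apply IsFractionRing.injective _ (RatFun d)
      rw [map_mul, map_mul, ← div_eq_div_iff hgL (algebraMap_ne_zero_of_eval_ne_zero hg'),
        ← hfg]
      exact hb'
    have hcont : ContinuousOn (fun q => (φ q j : ℂ) * eval (realToComplex q) g' -
        eval (realToComplex q) f') P :=
      ((hφcj j).mul (continuous_eval_realToComplex _).continuousOn).sub
        (continuous_eval_realToComplex _).continuousOn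
    have h2 := eq_zero_of_eval_mul_eq_zero hconv hfull hg hcont (fun q hq => by
      have := congrArg (eval (realToComplex q)) h1
      rw [map_mul, map_mul, hfφ j q hq] at this
      linear_combination this) p hp
    rw [← sub_eq_zero.1 h2, mul_div_cancel_right₀ _ hg']
  · exact fun j p hp => (hφP p hp).1.1 j
  · intro p hp
    have := (hφP p hp).2
    rwa [realMoment_apply] at this

end Backward

end ToricML

theorem proposition7p2 {d s : ℕ} (P : Set (Fin d → ℝ)) (hP : ToricML.IsLatticePolytope P)
    (hfull : (interior P).Nonempty) (m : Fin s → Fin d → ℤ)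
    (hm : ToricML.EnumeratesLatticePoints P m) (w : Fin s → ℝ) (hw : ∀ j, 0 < w j) :
    ToricML.HasRationalLinearPrecision P m w ↔
      ToricML.HasMLDegree (ToricML.scaledVeryAffineToric m w) 1 := by
  have himage := ToricML.eq_realMoment_image_stdSimplex hP hm
  have hs : 0 < s := by
    -- For `s = 0` the standard simplex is empty (an empty sum is not 1), whereas `P` has an
    -- interior point.
    rcases Nat.eq_zero_or_pos s with rfl | h
    · obtain ⟨p, hp⟩ := hfull
      have hp' := interior_subset hp
      rw [himage] at hp'
      obtain ⟨c, hc, -⟩ := hp'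
      simpa using hc.2
    · exact h
  exact ⟨ToricML.hasMLDegree_one_of_hasRationalLinearPrecision himage hfull hw hs,
    ToricML.hasRationalLinearPrecision_of_hasMLDegree_one hP hfull hm hw hs⟩
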